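/- Let $d\ge 1$, let $G$ be $U(d)$ or $SU(d)$, with Lie algebra $\mathfrak g=\mathfrak u(d)$ (skew-Hermitian matrices) or $\mathfrak g=\mathfrak{su}(d)$ (traceless skew-Hermitian matrices), regarded as a real Lie algebra. Call $g\in G$ \emph{general} if the closure of $\{g^k : k\in\mathbb N\}$ is a maximal torus of $G$, that is, a closed connected abelian subgroup of $G$ that is maximal under inclusion. Let $X_1\in\mathfrak g$ be a diagonal general direction, i.e. a diagonal matrix such that $\exp(X_1)$ is general in $G$. Let $$X_2=\sum_{j=1}^{d-1}c_j\,(E_{j,j+1}-E_{j+1,j}),\qquad c_j\in\mathbb R\setminus\{0\},$$ where $E_{j,k}$ are the standard matrix units. For $\varepsilon>0$ put $S_\varepsilon=\{\exp(\varepsilon X_1),\exp(\varepsilon X_2)\}\subset G$, and call $S_\varepsilon$ \emph{universal} if the set of finite products of elements of $S_\varepsilon$ is dense in $G$. Then: 1. The smallest real Lie algebra containing $X_1$ and $X_2$ is $\mathfrak g$. 2. For every $\varepsilon>0$ such that $\exp(\varepsilon X_1)$ is general, $\|\exp(\varepsilon X_1)-I\|<\sqrt2$, and $\|\exp(tX_2)-I\|<\sqrt2$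 for all $0<t\le\varepsilon$ (operator norm), $S_\varepsilon$ is universal. 3. If $G=U(d)$, there are $\varepsilon_0>0$ and a countable set $N\subset\mathbb R$ such that $S_\varepsilon$ is universal for every $\varepsilon\in(0,\varepsilon_0)\setminus N$. If $G=SU(d)$, there is $\varepsilon_0>0$ such that $S_\varepsilon$ is universal for every $\varepsilon\in(0,\varepsilon_0)$. -/

import Mathlib

open Set

attribute [local instance 100] LieRing.ofAssociativeRing

noncomputable section

namespace TwoGen

section Groups

variable {G : Type*} [Group G] [TopologicalSpace G]

/-- A torus of a topological group: a closed, connected, abelian subgroup. -/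
def IsTorus (T : Subgroup G) : Prop :=
  IsClosed (T : Set G) ∧ IsConnected (T : Set G) ∧ ∀ x ∈ T, ∀ y ∈ T, x * y = y * x

/-- A maximal torus: a closed, connected, abelian subgroup that is maximal under inclusion. -/
def IsMaximalTorus (T : Subgroup G) : Prop :=
  Maximal IsTorus T

/-- An element `g` is general if the closure of its set of powers `{g ^ k | k ∈ ℕ}` is a
maximal torus. -/
def IsGeneral (g : G) : Prop :=
  ∃ T : Subgroup G, IsMaximalTorus T ∧ closure (Submonoid.powers g : Set G) = (T : Set G)

/-- A set of gates is universal if the finite products of its elements are dense. -/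
def IsUniversal (S : Set G) : Prop :=
  closure (Submonoid.closure S : Set G) = univ

end Groups

/-- Complex `d × d` matrices. -/
abbrev Mat (d : ℕ) : Type := Matrix (Fin d) (Fin d) ℂ

/-- The group `U(d)`, with the topology of matrices. -/
abbrev UGroup (d : ℕ) : Type := Matrix.unitaryGroup (Fin d) ℂ

/-- The group `SU(d)`, with the topology of matrices. -/
abbrev SUGroup (d : ℕ) : Type := Matrix.specialUnitaryGroup (Fin d) ℂ

/-- The real Lie algebra `𝔲(d)` of skew-Hermitian matrices, with the commutator bracket. -/
def uLie (d : ℕ) : LieSubalgebra ℝ (Mat d) where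
  carrier := {A | A.conjTranspose = -A}
  add_mem' {a b} ha hb := by
    simp only [mem_ofPred_eq] at ha hb ⊢
    rw [Matrix.conjTranspose_add, ha, hb, neg_add]
  zero_mem' := by simp
  smul_mem' r a ha := by
    simp only [mem_ofPred_eq] at ha ⊢
    rw [Matrix.conjTranspose_smul, ha]
    simp
  lie_mem' {a b} ha hb := by
    have ha' : a.conjTranspose = -a := ha
    have hb' : b.conjTranspose = -b := hb
    change (⁅a, b⁆ : Mat d).conjTranspose = -⁅a, b⁆
    rw [Ring.lie_def, Matrix.conjTranspose_sub, Matrix.conjTranspose_mul,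
      Matrix.conjTranspose_mul, ha', hb']
    simp

/-- The real Lie algebra `𝔰𝔲(d)` of traceless skew-Hermitian matrices. -/
def suLie (d : ℕ) : LieSubalgebra ℝ (Mat d) where
  carrier := {A | A ∈ uLie d ∧ A.trace = 0}
  add_mem' {a b} ha hb := ⟨(uLie d).add_mem ha.1 hb.1, by
    rw [Matrix.trace_add, ha.2, hb.2, add_zero]⟩
  zero_mem' := ⟨(uLie d).zero_mem, by simp⟩
  smul_mem' r a ha := ⟨(uLie d).smul_mem r ha.1, by
    rw [Matrix.trace_smul, ha.2, smul_zero]⟩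
  lie_mem' {a b} ha hb := ⟨(uLie d).lie_mem ha.1 hb.1, by
    rw [Ring.lie_def, Matrix.trace_sub, Matrix.trace_mul_comm, sub_self]⟩

theorem mem_uLie {d : ℕ} {A : Mat d} : A ∈ uLie d ↔ A.conjTranspose = -A := Iff.rfl

theorem mem_suLie {d : ℕ} {A : Mat d} :
    A ∈ suLie d ↔ A.conjTranspose = -A ∧ A.trace = 0 := Iff.rfl

theorem exp_mem_unitaryGroup {d : ℕ} {A : Mat d} (hA : A ∈ uLie d) :
    NormedSpace.exp A ∈ Matrix.unitaryGroup (Fin d) ℂ := by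
  rw [Matrix.mem_unitaryGroup_iff, Matrix.star_eq_conjTranspose, ← Matrix.exp_conjTranspose,
    mem_uLie.1 hA, ← Matrix.exp_add_of_commute _ _ (Commute.neg_right (Commute.refl A)),
    add_neg_cancel, NormedSpace.exp_zero]

theorem det_exp_of_mem_uLie {d : ℕ} {A : Mat d} (hA : A ∈ uLie d) :
    (NormedSpace.exp A).det = Complex.exp A.trace := by
  have hH : (Complex.I • A).IsHermitian := by
    rw [Matrix.IsHermitian, Matrix.conjTranspose_smul, mem_uLie.1 hA]
    simp
  set U : Mat d := (hH.eigenvectorUnitary : Mat d)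
  set D : Fin d → ℂ := fun i => -Complex.I * (hH.eigenvalues i : ℂ)
  have hU : U * star U = 1 := Matrix.mem_unitaryGroup_iff.1 hH.eigenvectorUnitary.2
  have hinv : U⁻¹ = star U := Matrix.inv_eq_right_inv hU
  have hdet : IsUnit U.det := Matrix.isUnit_det_of_right_inverse hU
  have hunit : IsUnit U := (Matrix.isUnit_iff_isUnit_det U).2 hdet
  have hAD : A = U * Matrix.diagonal D * U⁻¹ := by
    have h := hH.spectral_theorem
    rw [Unitary.conjStarAlgAut_apply] at h
    have h2 : A = (-Complex.I) • (Complex.I • A) := by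
      rw [smul_smul]; simp
    have h3 : Matrix.diagonal D = (-Complex.I) •
        (Matrix.diagonal (RCLike.ofReal ∘ hH.eigenvalues) : Mat d) := by
      rw [← Matrix.diagonal_smul]; rfl
    rw [h3, hinv, Matrix.mul_smul, Matrix.smul_mul]
    exact h2.trans (congrArg (fun M : Mat d => (-Complex.I) • M) h)
  rw [hAD, Matrix.exp_conj _ _ hunit, Matrix.det_conj hunit, Matrix.trace_mul_cycle,
    Matrix.nonsing_inv_mul _ hdet, one_mul, Matrix.exp_diagonal, Matrix.det_diagonal,
    Matrix.trace_diagonal, Complex.exp_sum]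
  refine Finset.prod_congr rfl fun i _ => ?_
  rw [Complex.exp_eq_exp_ℂ]
  exact Pi.coe_exp D i

/-- The exponential map `𝔲(d) → U(d)`. -/
def expU {d : ℕ} (X : uLie d) : UGroup d :=
  ⟨NormedSpace.exp (X : Mat d), exp_mem_unitaryGroup X.2⟩

/-- The exponential map `𝔰𝔲(d) → SU(d)`. -/
def expSU {d : ℕ} (X : suLie d) : SUGroup d :=
  ⟨NormedSpace.exp (X : Mat d), Matrix.mem_specialUnitaryGroup_iff.2
    ⟨exp_mem_unitaryGroup X.2.1, by
      rw [det_exp_of_mem_uLie X.2.1, X.2.2, Complex.exp_zero]⟩⟩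

/-- A diagonal general direction in `𝔲(d)`: a diagonal `X` such that `exp X` is general in
`U(d)`. -/
def IsDiagGeneralDirectionU {d : ℕ} (X : uLie d) : Prop :=
  (X : Mat d).IsDiag ∧ IsGeneral (expU X)

/-- A diagonal general direction in `𝔰𝔲(d)`: a diagonal `X` such that `exp X` is general in
`SU(d)`. -/
def IsDiagGeneralDirectionSU {d : ℕ} (X : suLie d) : Prop :=
  (X : Mat d).IsDiag ∧ IsGeneral (expSU X)

/-- The matrix `∑ j, c j (E_{j,j+1} - E_{j+1,j})`, the sum running over the `d - 1` pairs of
neighbouring indices. -/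
def chain (d : ℕ) (c : Fin (d - 1) → ℝ) : Mat d :=
  ∑ j : Fin (d - 1), c j •
    (Matrix.single (⟨j, by omega⟩ : Fin d) (⟨j + 1, by omega⟩ : Fin d) (1 : ℂ) -
      Matrix.single (⟨j + 1, by omega⟩ : Fin d) (⟨j, by omega⟩ : Fin d) (1 : ℂ))

theorem chain_mem_suLie (d : ℕ) (c : Fin (d - 1) → ℝ) : chain d c ∈ suLie d := by
  refine (suLie d).toSubmodule.sum_mem fun j _ => (suLie d).toSubmodule.smul_mem _ ?_
  refine mem_suLie.2 ⟨?_, ?_⟩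
  · simp
  · rw [Matrix.trace_sub, Matrix.trace_single_eq_of_ne, Matrix.trace_single_eq_of_ne, sub_zero]
    all_goals simp

/-- The chain of nearest-neighbour couplings as an element of `𝔲(d)`. -/
def chainU (d : ℕ) (c : Fin (d - 1) → ℝ) : uLie d := ⟨chain d c, (chain_mem_suLie d c).1⟩

/-- The chain of nearest-neighbour couplings as an element of `𝔰𝔲(d)`. -/
def chainSU (d : ℕ) (c : Fin (d - 1) → ℝ) : suLie d := ⟨chain d c, chain_mem_suLie d c⟩

/-- The operator norm of a matrix acting on `ℂ^d` with the Euclidean norm. -/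
def opNorm {d : ℕ} (A : Mat d) : ℝ := ‖Matrix.toEuclideanCLM (n := Fin d) (𝕜 := ℂ) A‖

/-- `ε` is a small step for `X` if `‖exp (t X) - I‖ < √2` for all `0 < t ≤ ε`. -/
def IsSmallStep {d : ℕ} (X : Mat d) (ε : ℝ) : Prop :=
  ∀ t ∈ Ioc 0 ε, opNorm (NormedSpace.exp (t • X) - 1) < √2

end TwoGen

end

/-! Write X₁ = diag(iα_j). If exp X₁ is general, the closure of its powers is the whole diagonal
torus, and any relation among the α_j that forces a character to be trivial on the powers would make
it trivial on the torus. Hence the differences α_j − α_k with j ≠ k are pairwise distinct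
(`isSidon_of_phase_mem_closure`), and for U(d) also ∑ α_j ≠ 0. The off-diagonal matrix units then
span separate eigenlines of ad X₁, and interpolation on the eigenvalues isolates each of them.

The algebraic core is `traceless_mem_of_lie_mem`: a complex subspace stable under ad X₁ and ad X₂
that contains one nonscalar matrix contains every traceless matrix. Since 𝔲(d) meets i𝔲(d) only in
0, this descends to real subspaces of 𝔲(d) (`suLie_le_of_lie_mem`). Claim 1 is the case of the
generated Lie algebra itself.

For universality let H be the closed group generated by the two gates and V its space of
one-parameter directions (`tangent`). V is stable under conjugation by H. If ‖Z‖ < π/2, the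
eigenvalues of ad Z are the principal logarithms of those of conjugation by exp Z, so ad Z is a
polynomial in that conjugation (`lie_mem_of_exp_conj_mem`). Thus V is stable under ad X₁ and ad X₂,
and for d ≥ 2 a single nonscalar element of V suffices. In claim 2 it is X₁, because H contains the
diagonal torus. In claim 3 it is a limiting direction of iterated commutators that tend to 1 without
reaching it (`exists_mem_tangent_trace_eq_zero`).

Then V ⊇ 𝔰𝔲(d), and surjectivity of exp gives SU(d) ⊆ H. For U(d) it remains that det maps H onto
the circle: the torus does this in claim 2, and in claim 3 an irrational rotation does, N being the
set of ε for which ε ∑ α_j / 2π is rational. -/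

namespace TwoGen

/-! ### Subspaces stable under ad X₁ and ad X₂. -/

section Algebra

variable {d : ℕ}

/-- If a complex subspace of matrices is invariant under entrywise multiplication by `f`, then it
is invariant under entrywise multiplication by any function of `f`. -/
theorem entrywise_comp_mem (W : Submodule ℂ (Mat d)) (f : Fin d → Fin d → ℂ)
    (hW : ∀ Y ∈ W, (Matrix.of fun a b => f a b * Y a b : Mat d) ∈ W) (φ : ℂ → ℂ)
    {Y : Mat d} (hY : Y ∈ W) : (Matrix.of fun a b => φ (f a b) * Y a b : Mat d) ∈ W := by
  have hpoly : ∀ p : Polynomial ℂ, (Matrix.of fun a b => p.eval (f a b) * Y a b : Mat d) ∈ W := by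
    intro p
    induction p using Polynomial.induction_on' with
    | add p q hp hq =>
      convert W.add_mem hp hq using 1
      ext a b
      simp [add_mul]
    | monomial n z =>
      induction n with
      | zero =>
        convert W.smul_mem z hY using 1
        ext a b
        simp
      | succ n ih =>
        convert hW _ ih using 1
        ext a b
        simp
        ring
  classical
  -- Only the finitely many values of `f` matter, and on them `φ` agrees with its Lagrange
  -- interpolation polynomial.
  let s : Finset ℂ := Finset.univ.image fun ab : Fin d × Fin d => f ab.1 ab.2
  convert hpoly (Lagrange.interpolate s id φ) using 1
  ext a b
  have hab : f a b ∈ s := Finset.mem_image.2 ⟨(a, b), Finset.mem_univ _, rfl⟩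
  have := Lagrange.eval_interpolate_at_node φ (s := s) (v := id) (injOn_id _) hab
  simp only [id] at this
  change φ (f a b) * Y a b = (Polynomial.eval (f a b) (Lagrange.interpolate s id φ)) * Y a b
  rw [this]

/-- The ordered differences of distinct entries of `x` are pairwise distinct. -/
def IsSidon (x : Fin d → ℂ) : Prop :=
  ∀ j k l m, j ≠ k → x j - x k = x l - x m → j = l ∧ k = m

theorem IsSidon.ne {x : Fin d → ℂ} (hx : IsSidon x) {j k : Fin d} (hjk : j ≠ k) : x j ≠ x k := by
  intro h
  have := hx j k j j hjk (by rw [h])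
  exact hjk this.2.symm

theorem lie_diagonal (x : Fin d → ℂ) (Y : Mat d) :
    ⁅Matrix.diagonal x, Y⁆ = Matrix.of fun a b => (x a - x b) * Y a b := by
  ext a b
  simp [Ring.lie_def]
  ring

/-- By the Sidon property the eigenvalue x_j − x_k of ad(diag x) occurs at the entry (j, k) only, so
the indicator function of this eigenvalue cuts out that entry. -/
theorem single_mem_of_lie_diagonal_mem {W : Submodule ℂ (Mat d)} {x : Fin d → ℂ} (hx : IsSidon x)
    (hW : ∀ Y ∈ W, ⁅Matrix.diagonal x, Y⁆ ∈ W) {Y : Mat d} (hY : Y ∈ W) {j k : Fin d}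
    (hjk : j ≠ k) (hne : Y j k ≠ 0) : Matrix.single j k (1 : ℂ) ∈ W := by
  classical
  have h := entrywise_comp_mem W (fun a b => x a - x b)
    (fun Y hY => by rw [← lie_diagonal]; exact hW Y hY)
    (fun z => if z = x j - x k then 1 else 0) hY
  convert W.smul_mem (Y j k)⁻¹ h using 1
  ext a b
  by_cases hab : j = a ∧ k = b
  · obtain ⟨rfl, rfl⟩ := hab
    simp [hne]
  · rw [Matrix.single_apply, if_neg hab]
    have : ¬ (x a - x b = x j - x k) := fun h => hab (hx j k a b hjk h.symm)
    simp [this]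

/-- The matrices whose commutators preserve `W`. -/
def lieNormalizer (W : Submodule ℂ (Mat d)) : Submodule ℂ (Mat d) where
  carrier := {Z | ∀ Y ∈ W, ⁅Z, Y⁆ ∈ W}
  add_mem' {a b} ha hb Y hY := by rw [add_lie]; exact W.add_mem (ha Y hY) (hb Y hY)
  zero_mem' Y _ := by rw [zero_lie]; exact W.zero_mem
  smul_mem' z a ha Y hY := by
    rw [Ring.lie_def, smul_mul_assoc, mul_smul_comm, ← smul_sub, ← Ring.lie_def]
    exact W.smul_mem z (ha Y hY)

theorem mem_lieNormalizer {W : Submodule ℂ (Mat d)} {Z : Mat d} :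
    Z ∈ lieNormalizer W ↔ ∀ Y ∈ W, ⁅Z, Y⁆ ∈ W := Iff.rfl

theorem lie_mem_lieNormalizer {W : Submodule ℂ (Mat d)} {A B : Mat d} (hA : A ∈ lieNormalizer W)
    (hB : B ∈ lieNormalizer W) : ⁅A, B⁆ ∈ lieNormalizer W := by
  intro Y hY
  rw [lie_lie]
  exact W.sub_mem (hA _ (hB _ hY)) (hB _ (hA _ hY))

theorem lie_single_single {j k l m : Fin d} :
    ⁅(Matrix.single j k (1 : ℂ)), Matrix.single l m (1 : ℂ)⁆ =
      (if k = l then Matrix.single j m (1 : ℂ) else 0) -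
        if m = j then Matrix.single l k (1 : ℂ) else 0 := by
  rw [Ring.lie_def]
  congr 1
  · split_ifs with h
    · rw [h, Matrix.single_mul_single_same, one_mul]
    · rw [Matrix.single_mul_single_of_ne _ _ _ _ h]
  · split_ifs with h
    · rw [h, Matrix.single_mul_single_same, one_mul]
    · rw [Matrix.single_mul_single_of_ne _ _ _ _ h]

theorem chain_apply_succ (c : Fin (d - 1) → ℝ) (j : Fin (d - 1)) :
    chain d c ⟨j, by omega⟩ ⟨j + 1, by omega⟩ = c j ∧
      chain d c ⟨j + 1, by omega⟩ ⟨j, by omega⟩ = -c j := by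
  constructor
  · rw [chain, Matrix.sum_apply, Finset.sum_eq_single j]
    · simp
    · intro i _ hij
      have : (i : ℕ) ≠ j := fun h => hij (Fin.ext h)
      simp only [Matrix.smul_apply, Matrix.sub_apply, Matrix.single_apply, Fin.mk.injEq]
      rw [if_neg (by omega), if_neg (by omega), sub_zero, smul_zero]
    · simp
  · rw [chain, Matrix.sum_apply, Finset.sum_eq_single j]
    · simp
    · intro i _ hij
      have : (i : ℕ) ≠ j := fun h => hij (Fin.ext h)
      simp only [Matrix.smul_apply, Matrix.sub_apply, Matrix.single_apply, Fin.mk.injEq]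
      rw [if_neg (by omega), if_neg (by omega), sub_zero, smul_zero]
    · simp

/-- Induction on the distance |k − j|, with E_{jk} = [E_{jl}, E_{lk}] for l the neighbour of k on
the side of j. -/
theorem single_mem_of_single_succ_mem {N : Submodule ℂ (Mat d)}
    (hN : ∀ A ∈ N, ∀ B ∈ N, ⁅A, B⁆ ∈ N)
    (hs : ∀ j k : Fin d, (j : ℕ) + 1 = k →
      Matrix.single j k (1 : ℂ) ∈ N ∧ Matrix.single k j (1 : ℂ) ∈ N)
    {j k : Fin d} (hjk : j ≠ k) : Matrix.single j k (1 : ℂ) ∈ N := by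
  have key : ∀ n : ℕ, ∀ j k : Fin d, (j : ℕ) + n + 1 = k →
      Matrix.single j k (1 : ℂ) ∈ N ∧ Matrix.single k j (1 : ℂ) ∈ N := by
    intro n
    induction n with
    | zero => intro j k h; exact hs j k h
    | succ n ih =>
      intro j k h
      have hl : (j : ℕ) + n + 1 < d := by omega
      obtain ⟨h1, h2⟩ := ih j ⟨j + n + 1, hl⟩ rfl
      obtain ⟨h3, h4⟩ := hs ⟨j + n + 1, hl⟩ k (by simp; omega)
      have hkj : k ≠ j := fun h' => by subst h'; omega
      constructor
      · simpa [lie_single_single, hkj] using hN _ h1 _ h3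
      · simpa [lie_single_single, hkj.symm] using hN _ h4 _ h2
  rcases lt_or_gt_of_ne hjk with h | h
  · exact (key (k - j - 1) j k (by have : (j : ℕ) < k := h; omega)).1
  · exact (key (j - k - 1) k j (by have : (k : ℕ) < j := h; omega)).2

theorem traceless_mem_of_lie_single_mem {W : Submodule ℂ (Mat d)}
    (hN : ∀ j k : Fin d, j ≠ k → ∀ Y ∈ W, ⁅Matrix.single j k (1 : ℂ), Y⁆ ∈ W)
    {j k : Fin d} (hjk : j ≠ k) (h : Matrix.single j k (1 : ℂ) ∈ W)
    {Z : Mat d} (hZ : Z.trace = 0) : Z ∈ W := by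
  have left : ∀ {j k l : Fin d}, j ≠ k → Matrix.single j k (1 : ℂ) ∈ W → l ≠ k →
      Matrix.single l k (1 : ℂ) ∈ W := by
    intro j k l hjk h hlk
    by_cases hlj : l = j
    · rwa [hlj]
    · simpa [lie_single_single, hlk.symm] using hN l j hlj _ h
  have right : ∀ {j k l : Fin d}, j ≠ k → Matrix.single j k (1 : ℂ) ∈ W → j ≠ l →
      Matrix.single j l (1 : ℂ) ∈ W := by
    intro j k l hjk h hjl
    by_cases hlk : l = k
    · rwa [hlk]
    · have h1 := W.neg_mem (hN k l (Ne.symm hlk) _ h)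
      simpa [lie_single_single, Ne.symm hjl] using h1
  have flip : ∀ {j k : Fin d}, j ≠ k → Matrix.single j k (1 : ℂ) ∈ W →
      Matrix.single k j (1 : ℂ) ∈ W := by
    intro j k hjk h
    have h1 := hN k j hjk.symm _ (hN k j hjk.symm _ h)
    rw [lie_single_single, if_pos rfl, if_pos rfl, lie_sub, lie_single_single, lie_single_single,
      if_neg hjk, if_pos rfl, if_pos rfl, if_neg hjk] at h1
    -- The double bracket [E_{kj}, [E_{kj}, E_{jk}]] equals −2 E_{kj}.
    have h2 := W.smul_mem (-(1 / 2 : ℂ)) h1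
    convert h2 using 1
    module
  have off : ∀ l m : Fin d, l ≠ m → Matrix.single l m (1 : ℂ) ∈ W := by
    intro l m hlm
    by_cases hlk : l = k
    · subst hlk
      exact right hjk.symm (flip hjk h) hlm
    · exact right hlk (left hjk h hlk) hlm
  have diag : ∀ l : Fin d, Matrix.single l l (1 : ℂ) - Matrix.single j j (1 : ℂ) ∈ W := by
    intro l
    by_cases hlj : l = j
    · simp [hlj]
    · simpa [lie_single_single] using hN l j hlj _ (off j l (Ne.symm hlj))
  -- Subtracting E_{jj} from each diagonal unit changes the sum by (tr Z) E_{jj} = 0, and turns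
  -- every term into one already known to lie in `W`.
  have hdec : Z = ∑ l, ∑ m, (Z l m) • (Matrix.single l m (1 : ℂ) -
      if l = m then Matrix.single j j (1 : ℂ) else 0) := by
    have h1 : ∑ l, ∑ m, (Z l m) • (if l = m then Matrix.single j j (1 : ℂ) else 0) = 0 := by
      simp only [smul_ite, smul_zero, Finset.sum_ite_eq, Finset.mem_univ, if_true]
      rw [← Finset.sum_smul]
      have : ∑ i, Z i i = 0 := hZ
      rw [this, zero_smul]
    simp only [smul_sub, Finset.sum_sub_distrib]
    rw [h1, sub_zero]
    conv_lhs => rw [Matrix.matrix_eq_sum_single Z]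
    simp
  rw [hdec]
  refine W.sum_mem fun l _ => W.sum_mem fun m _ => W.smul_mem _ ?_
  by_cases hlm : l = m
  · subst hlm
    simpa using diag l
  · simpa [hlm] using off l m hlm

/-- The normalizer of W, closed under brackets by the Jacobi identity, contains both generators. It
is itself stable under ad(diag x), so the neighbouring matrix units can be extracted from the chain
there, and they generate all off-diagonal units. Only then is Y used, to put one off-diagonal unit
into W. -/
theorem traceless_mem_of_lie_mem {W : Submodule ℂ (Mat d)} {x : Fin d → ℂ} (hx : IsSidon x)
    {c : Fin (d - 1) → ℝ} (hc : ∀ j, c j ≠ 0)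
    (h1 : ∀ Y ∈ W, ⁅Matrix.diagonal x, Y⁆ ∈ W) (h2 : ∀ Y ∈ W, ⁅chain d c, Y⁆ ∈ W)
    {Y : Mat d} (hY : Y ∈ W) (hYs : ∀ z : ℂ, Y ≠ z • 1) {Z : Mat d} (hZ : Z.trace = 0) :
    Z ∈ W := by
  have hN : ∀ j k : Fin d, j ≠ k → ∀ Y ∈ W, ⁅Matrix.single j k (1 : ℂ), Y⁆ ∈ W := by
    intro j k hjk
    refine mem_lieNormalizer.1 (single_mem_of_single_succ_mem
      (N := lieNormalizer W) (fun A hA B hB => lie_mem_lieNormalizer hA hB) ?_ hjk)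
    intro j k hjk
    have hne : j ≠ k := fun h => by subst h; omega
    have hj : (j : ℕ) < d - 1 := by omega
    have hk : k = ⟨(⟨j, hj⟩ : Fin (d - 1)) + 1, by simp; omega⟩ := Fin.ext hjk.symm
    have hcj := hc ⟨j, hj⟩
    have hch := chain_apply_succ c ⟨j, hj⟩
    constructor
    · refine single_mem_of_lie_diagonal_mem hx (fun Y hY => lie_mem_lieNormalizer h1 hY)
        (Y := chain d c) h2 hne ?_
      rw [hk]
      rw [show chain d c j _ = _ from hch.1]
      exact_mod_cast hcj
    · refine single_mem_of_lie_diagonal_mem hx (fun Y hY => lie_mem_lieNormalizer h1 hY)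
        (Y := chain d c) h2 hne.symm ?_
      rw [hk]
      rw [show chain d c _ j = _ from hch.2]
      simpa using hcj
  have : ∃ j k : Fin d, j ≠ k ∧ Matrix.single j k (1 : ℂ) ∈ W := by
    by_cases hoff : ∃ j k : Fin d, j ≠ k ∧ Y j k ≠ 0
    · obtain ⟨j, k, hjk, hne⟩ := hoff
      exact ⟨j, k, hjk, single_mem_of_lie_diagonal_mem hx h1 hY hjk hne⟩
    · push Not at hoff
      have hdiag : Y = Matrix.diagonal fun i => Y i i := by
        ext a b
        by_cases hab : a = b
        · simp [hab]
        · simp [hab, hoff a b hab]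
      have : ∃ j k : Fin d, Y j j ≠ Y k k := by
        by_contra! hall
        rcases isEmpty_or_nonempty (Fin d) with he | ⟨⟨i⟩⟩
        · exact hYs 0 (Subsingleton.elim _ _)
        · refine hYs (Y i i) ?_
          rw [hdiag, Matrix.smul_one_eq_diagonal]
          congr 1
          funext j
          simpa using hall j i
      obtain ⟨j, k, hjk⟩ := this
      have hne : j ≠ k := fun h => hjk (by rw [h])
      refine ⟨j, k, hne, ?_⟩
      -- For diagonal Y one has [E_{jk}, Y] = (Y_{kk} − Y_{jj}) E_{jk}.
      have h3 := W.smul_mem (Y k k - Y j j)⁻¹ (hN j k hne Y hY)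
      convert h3 using 1
      rw [← lie_skew, hdiag, lie_diagonal]
      ext a b
      by_cases hab : j = a ∧ k = b
      · obtain ⟨rfl, rfl⟩ := hab
        simp
        field_simp [sub_ne_zero.2 hjk.symm]
      · simp [Matrix.single_apply, hab]
  obtain ⟨j, k, hjk, h⟩ := this
  exact traceless_mem_of_lie_single_mem hN hjk h hZ

theorem exists_add_smul_of_mem_span {V : Submodule ℝ (Mat d)} {X : Mat d}
    (hX : X ∈ Submodule.span ℂ (V : Set (Mat d))) :
    ∃ A ∈ V, ∃ B ∈ V, X = A + Complex.I • B := by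
  induction hX using Submodule.span_induction with
  | mem x hx => exact ⟨x, hx, 0, V.zero_mem, by simp⟩
  | zero => exact ⟨0, V.zero_mem, 0, V.zero_mem, by simp⟩
  | add x y _ _ hx hy =>
    obtain ⟨A, hA, B, hB, rfl⟩ := hx
    obtain ⟨A', hA', B', hB', rfl⟩ := hy
    exact ⟨A + A', V.add_mem hA hA', B + B', V.add_mem hB hB', by module⟩
  | smul z x _ hx =>
    obtain ⟨A, hA, B, hB, rfl⟩ := hx
    refine ⟨z.re • A - z.im • B, V.sub_mem (V.smul_mem _ hA) (V.smul_mem _ hB),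
      z.im • A + z.re • B, V.add_mem (V.smul_mem _ hA) (V.smul_mem _ hB), ?_⟩
    ext a b
    simp only [Matrix.smul_apply, Matrix.add_apply, Matrix.sub_apply, smul_eq_mul,
      Complex.real_smul]
    conv_lhs => rw [← Complex.re_add_im z]
    linear_combination (z.im * B a b : ℂ) * Complex.I_mul_I

/-- In X = A + iB with A, B ∈ V, the part iB is Hermitian, and it is also skew-Hermitian because X
and A are; so it vanishes. -/
theorem mem_of_mem_span {V : Submodule ℝ (Mat d)} (hV : ∀ A ∈ V, A ∈ uLie d) {X : Mat d}
    (hXu : X ∈ uLie d) (hX : X ∈ Submodule.span ℂ (V : Set (Mat d))) : X ∈ V := by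
  obtain ⟨A, hA, B, hB, rfl⟩ := exists_add_smul_of_mem_span hX
  have h := mem_uLie.1 hXu
  rw [Matrix.conjTranspose_add, Matrix.conjTranspose_smul, mem_uLie.1 (hV A hA),
    mem_uLie.1 (hV B hB)] at h
  have h0 : (2 : ℂ) • (Complex.I • B) = 0 := by
    have : Complex.I • B = -(Complex.I • B) := by
      have h' : -A + Complex.I • B = -A + -(Complex.I • B) := by simpa [add_comm] using h
      exact add_left_cancel h'
    rw [two_smul]
    nth_rewrite 2 [this]
    simp
  have h1 : Complex.I • B = 0 := (smul_eq_zero.1 h0).resolve_left two_ne_zero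
  rwa [h1, add_zero]

theorem map_mem_span_of_map_mem {V : Submodule ℝ (Mat d)} (T : Mat d →ₗ[ℂ] Mat d)
    (hT : ∀ Y ∈ V, T Y ∈ V) {Y : Mat d} (hY : Y ∈ Submodule.span ℂ (V : Set (Mat d))) :
    T Y ∈ Submodule.span ℂ (V : Set (Mat d)) := by
  have : Submodule.span ℂ (V : Set (Mat d)) ≤ (Submodule.span ℂ (V : Set (Mat d))).comap T :=
    Submodule.span_le.2 fun Y hY => Submodule.subset_span (hT Y hY)
  exact this hY

/-- The commutator with `X` as a complex linear map. -/
noncomputable def adMap (X : Mat d) : Mat d →ₗ[ℂ] Mat d :=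
  LinearMap.mulLeft ℂ X - LinearMap.mulRight ℂ X

theorem adMap_apply (X Y : Mat d) : adMap X Y = ⁅X, Y⁆ := by
  simp [adMap, Ring.lie_def]

theorem suLie_le_of_lie_mem {V : Submodule ℝ (Mat d)} (hV : ∀ A ∈ V, A ∈ uLie d)
    {x : Fin d → ℂ} (hx : IsSidon x) {c : Fin (d - 1) → ℝ} (hc : ∀ j, c j ≠ 0)
    (h1 : ∀ Y ∈ V, ⁅Matrix.diagonal x, Y⁆ ∈ V) (h2 : ∀ Y ∈ V, ⁅chain d c, Y⁆ ∈ V)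
    {Y : Mat d} (hY : Y ∈ V) (hYs : ∀ z : ℂ, Y ≠ z • 1) {Z : Mat d} (hZ : Z ∈ suLie d) :
    Z ∈ V := by
  refine mem_of_mem_span hV hZ.1 ?_
  refine traceless_mem_of_lie_mem hx hc ?_ ?_ (Submodule.subset_span hY) hYs hZ.2
  · intro Y hY
    rw [← adMap_apply]
    exact map_mem_span_of_map_mem _ (fun Y hY => by rw [adMap_apply]; exact h1 Y hY) hY
  · intro Y hY
    rw [← adMap_apply]
    exact map_mem_span_of_map_mem _ (fun Y hY => by rw [adMap_apply]; exact h2 Y hY) hY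

theorem IsSidon.diagonal_ne_smul_one (hd : 2 ≤ d) {x : Fin d → ℂ} (hx : IsSidon x) (z : ℂ) :
    Matrix.diagonal x ≠ z • (1 : Mat d) := by
  intro h
  have h0 := congrFun (congrFun h ⟨0, by omega⟩) ⟨0, by omega⟩
  have h1 := congrFun (congrFun h ⟨1, by omega⟩) ⟨1, by omega⟩
  simp at h0 h1
  exact hx.ne (j := ⟨0, by omega⟩) (k := ⟨1, by omega⟩) (by simp) (h0.trans h1.symm)

theorem eq_zero_of_mem_suLie (hd : d < 2) {Z : Mat d} (hZ : Z ∈ suLie d) : Z = 0 := by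
  have hs : Subsingleton (Fin d) := Fin.subsingleton_iff_le_one.2 (by omega)
  ext a b
  have h := hZ.2
  rw [Matrix.trace, Fintype.sum_subsingleton _ a] at h
  rw [Subsingleton.elim b a]
  simpa using h

theorem suLie_le_lieSpan {x : Fin d → ℂ} (hx : IsSidon x) (hxu : Matrix.diagonal x ∈ uLie d)
    {c : Fin (d - 1) → ℝ} (hc : ∀ j, c j ≠ 0) :
    suLie d ≤ LieSubalgebra.lieSpan ℝ (Mat d) {Matrix.diagonal x, chain d c} := by
  set L := LieSubalgebra.lieSpan ℝ (Mat d) {Matrix.diagonal x, chain d c}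
  intro Z hZ
  rcases lt_or_ge d 2 with hd | hd
  · rw [eq_zero_of_mem_suLie hd hZ]
    exact L.zero_mem
  have hL : L ≤ uLie d := LieSubalgebra.lieSpan_le.2 (by
    rintro A (rfl | rfl)
    · exact hxu
    · exact (chain_mem_suLie d c).1)
  have m1 : Matrix.diagonal x ∈ L := LieSubalgebra.subset_lieSpan (by simp)
  have m2 : chain d c ∈ L := LieSubalgebra.subset_lieSpan (by simp)
  exact suLie_le_of_lie_mem (V := L.toSubmodule) hL hx hc (fun Y hY => L.lie_mem m1 hY)
    (fun Y hY => L.lie_mem m2 hY) m1 (hx.diagonal_ne_smul_one hd) hZ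

theorem lieSpan_eq_suLie {x : Fin d → ℂ} (hx : IsSidon x) (hxu : Matrix.diagonal x ∈ suLie d)
    {c : Fin (d - 1) → ℝ} (hc : ∀ j, c j ≠ 0) :
    LieSubalgebra.lieSpan ℝ (Mat d) {Matrix.diagonal x, chain d c} = suLie d := by
  refine le_antisymm (LieSubalgebra.lieSpan_le.2 ?_) (suLie_le_lieSpan hx hxu.1 hc)
  rintro A (rfl | rfl)
  · exact hxu
  · exact chain_mem_suLie d c

theorem trace_eq_im_mul_I {A : Mat d} (hA : A ∈ uLie d) : A.trace = A.trace.im * Complex.I := by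
  have h := congrArg Matrix.trace (mem_uLie.1 hA)
  rw [Matrix.trace_conjTranspose, Matrix.trace_neg] at h
  have h2 := congrArg Complex.re h
  simp at h2
  apply Complex.ext
  · simp; linarith
  · simp

theorem lieSpan_eq_uLie {x : Fin d → ℂ} (hx : IsSidon x) (hxu : Matrix.diagonal x ∈ uLie d)
    (htr : (Matrix.diagonal x).trace ≠ 0) {c : Fin (d - 1) → ℝ} (hc : ∀ j, c j ≠ 0) :
    LieSubalgebra.lieSpan ℝ (Mat d) {Matrix.diagonal x, chain d c} = uLie d := by
  set L := LieSubalgebra.lieSpan ℝ (Mat d) {Matrix.diagonal x, chain d c} with hL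
  refine le_antisymm (LieSubalgebra.lieSpan_le.2 ?_) fun Z hZ => ?_
  · rintro A (rfl | rfl)
    · exact hxu
    · exact (chain_mem_suLie d c).1
  · have m1 : Matrix.diagonal x ∈ L := LieSubalgebra.subset_lieSpan (by simp)
    -- A real multiple of the diagonal generator can match the trace of Z, since both traces are
    -- purely imaginary.
    set r : ℝ := Z.trace.im / (Matrix.diagonal x).trace.im
    have hr : Z - r • Matrix.diagonal x ∈ suLie d := by
      refine ⟨(uLie d).sub_mem hZ ((uLie d).smul_mem r hxu), ?_⟩
      have h1 := trace_eq_im_mul_I hxu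
      have hne : (Matrix.diagonal x).trace.im ≠ 0 := fun h => htr (by rw [h1, h]; simp)
      rw [Matrix.trace_sub, Matrix.trace_smul, trace_eq_im_mul_I hZ, h1, Complex.real_smul,
        ← mul_assoc, ← Complex.ofReal_mul]
      have hr : r * (Matrix.diagonal x).trace.im = Z.trace.im := div_mul_cancel₀ _ hne
      rw [hr, sub_self]
    have := L.add_mem (suLie_le_lieSpan hx hxu hc hr) (L.smul_mem r m1)
    simpa using this

end Algebra

/-! ### From conjugation by exp Z to the commutator with Z. -/

section Analysis

open Filter Topology
open scoped Matrix.Norms.L2Operator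

variable {d : ℕ}

theorem exists_eq_conj_diagonal {A : Mat d} (hA : A ∈ uLie d) :
    ∃ U ∈ Matrix.unitaryGroup (Fin d) ℂ, ∃ θ : Fin d → ℝ,
      A = U * Matrix.diagonal (fun j => θ j * Complex.I) * star U := by
  have hH : (-Complex.I • A).IsHermitian := by
    rw [Matrix.IsHermitian, Matrix.conjTranspose_smul, mem_uLie.1 hA]
    simp
  refine ⟨hH.eigenvectorUnitary, hH.eigenvectorUnitary.2, hH.eigenvalues, ?_⟩
  have h := hH.spectral_theorem
  rw [Unitary.conjStarAlgAut_apply] at h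
  have h2 : A = Complex.I • (-Complex.I • A) := by
    rw [smul_smul]; simp
  have h3 : (Matrix.diagonal fun j => (hH.eigenvalues j : ℂ) * Complex.I) = Complex.I •
      (Matrix.diagonal (RCLike.ofReal ∘ hH.eigenvalues) : Mat d) := by
    rw [← Matrix.diagonal_smul]
    congr 1
    funext j
    simp [mul_comm]
  rw [h3, Matrix.mul_smul, Matrix.smul_mul]
  exact h2.trans (congrArg (fun M : Mat d => Complex.I • M) h)

theorem exp_conj_unitary {U : Mat d} (hU : U ∈ Matrix.unitaryGroup (Fin d) ℂ) (A : Mat d) :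
    NormedSpace.exp (U * A * star U) = U * NormedSpace.exp A * star U := by
  have h := Matrix.mem_unitaryGroup_iff.1 hU
  have hinv : U⁻¹ = star U := Matrix.inv_eq_right_inv h
  rw [← hinv, Matrix.exp_conj _ _
    ((Matrix.isUnit_iff_isUnit_det U).2 (Matrix.isUnit_det_of_right_inverse h))]

theorem exp_diagonal (x : Fin d → ℂ) :
    NormedSpace.exp (Matrix.diagonal x : Mat d) = Matrix.diagonal fun j => Complex.exp (x j) := by
  rw [Matrix.exp_diagonal]
  congr 1
  funext j
  rw [Complex.exp_eq_exp_ℂ]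
  exact Pi.coe_exp x j

theorem exp_smul_conj_diagonal {U : Mat d} (hU : U ∈ Matrix.unitaryGroup (Fin d) ℂ)
    (x : Fin d → ℂ) (t : ℝ) :
    NormedSpace.exp (t • (U * Matrix.diagonal x * star U)) =
      U * Matrix.diagonal (fun j => Complex.exp (t * x j)) * star U := by
  rw [← Matrix.smul_mul, ← Matrix.mul_smul, exp_conj_unitary hU, ← Matrix.diagonal_smul,
    exp_diagonal]
  simp

theorem star_mem_unitaryGroup {U : Mat d} (hU : U ∈ Matrix.unitaryGroup (Fin d) ℂ) :
    star U ∈ Matrix.unitaryGroup (Fin d) ℂ := Unitary.star_mem hU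

theorem norm_conj_unitary {U : Mat d} (hU : U ∈ Matrix.unitaryGroup (Fin d) ℂ) (A : Mat d) :
    ‖U * A * star U‖ = ‖A‖ := by
  rw [CStarRing.norm_mul_mem_unitary _ (star_mem_unitaryGroup hU),
    CStarRing.norm_mem_unitary_mul _ hU]

theorem exp_neg_eq_star {A : Mat d} (hA : A ∈ uLie d) :
    NormedSpace.exp (-A) = star (NormedSpace.exp A) := by
  rw [Matrix.star_eq_conjTranspose, ← Matrix.exp_conjTranspose, mem_uLie.1 hA]

/-- A complex subspace of matrices preserved by conjugation with `exp Z`, where `Z` is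
skew-Hermitian with `‖Z‖ < π / 2`, is preserved by the commutator with `Z`. -/
theorem lie_mem_of_exp_conj_mem (W : Submodule ℂ (Mat d)) {Z : Mat d} (hZ : Z ∈ uLie d)
    (hn : ‖Z‖ < Real.pi / 2)
    (hW : ∀ Y ∈ W, NormedSpace.exp Z * Y * star (NormedSpace.exp Z) ∈ W)
    {Y : Mat d} (hY : Y ∈ W) : ⁅Z, Y⁆ ∈ W := by
  obtain ⟨U, hU, θ, rfl⟩ := exists_eq_conj_diagonal hZ
  have hUU := Matrix.mem_unitaryGroup_iff.1 hU
  have hUU' := Matrix.mem_unitaryGroup_iff'.1 hU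
  rw [norm_conj_unitary hU, Matrix.l2_opNorm_diagonal] at hn
  have hθ : ∀ j, |θ j| < Real.pi / 2 := fun j => by
    have := (norm_le_pi_norm (fun j => (θ j : ℂ) * Complex.I) j).trans_lt hn
    simpa using this
  let W' : Submodule ℂ (Mat d) :=
    W.comap ((LinearMap.mulLeft ℂ U).comp (LinearMap.mulRight ℂ (star U)))
  have hmem : ∀ Y, Y ∈ W' ↔ U * Y * star U ∈ W := fun Y => by
    simp [W', mul_assoc]
  have hE : ∀ Y ∈ W', (Matrix.of fun a b =>
      Complex.exp ((θ a - θ b : ℝ) * Complex.I) * Y a b : Mat d) ∈ W' := by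
    intro Y hY
    rw [hmem] at hY ⊢
    convert hW _ hY using 1
    rw [exp_conj_unitary hU, exp_diagonal]
    simp only [star_mul, star_star, mul_assoc]
    rw [← mul_assoc (star U) U, hUU', one_mul, ← mul_assoc (star U) U, hUU', one_mul]
    congr 1
    rw [← mul_assoc, ← mul_assoc]
    congr 1
    ext a b
    rw [Matrix.star_eq_conjTranspose, Matrix.diagonal_conjTranspose]
    simp only [Matrix.of_apply, Matrix.mul_diagonal, Matrix.diagonal_mul, Pi.star_apply,
      RCLike.star_def, ← Complex.exp_conj]
    rw [mul_right_comm, ← Complex.exp_add]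
    congr 2
    simp
    ring
  have hY' : star U * Y * U ∈ W' := by
    rw [hmem]
    convert hY using 1
    simp only [← mul_assoc]
    rw [hUU, one_mul, mul_assoc, hUU, mul_one]
  -- In an eigenbasis, conjugation multiplies the entry (a, b) by e^{i(θ_a − θ_b)}. As |θ_a − θ_b| <
  -- π, the principal logarithm returns i(θ_a − θ_b), the multiplier of the commutator.
  have h := entrywise_comp_mem W' _ hE Complex.log hY'
  have hlog : ∀ a b, Complex.log (Complex.exp ((θ a - θ b : ℝ) * Complex.I)) =
      θ a * Complex.I - θ b * Complex.I := by
    intro a b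
    have h1 := abs_lt.1 (hθ a)
    have h2 := abs_lt.1 (hθ b)
    rw [Complex.log_exp]
    · push_cast; ring
    · simp; linarith
    · simp; linarith
  simp only [hlog] at h
  rw [← lie_diagonal, hmem] at h
  convert h using 1
  simp only [Ring.lie_def, mul_sub, sub_mul, mul_assoc]
  rw [hUU, mul_one, ← mul_assoc U (star U), hUU, one_mul]

theorem lie_mem_of_exp_conj_mem_real (V : Submodule ℝ (Mat d)) (hV : ∀ A ∈ V, A ∈ uLie d)
    {Z : Mat d} (hZ : Z ∈ uLie d) (hn : ‖Z‖ < Real.pi / 2)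
    (hW : ∀ Y ∈ V, NormedSpace.exp Z * Y * star (NormedSpace.exp Z) ∈ V)
    {Y : Mat d} (hY : Y ∈ V) : ⁅Z, Y⁆ ∈ V := by
  refine mem_of_mem_span hV ((uLie d).lie_mem hZ (hV Y hY)) ?_
  refine lie_mem_of_exp_conj_mem _ hZ hn (fun Y hY => ?_) (Submodule.subset_span hY)
  have := map_mem_span_of_map_mem ((LinearMap.mulRight ℂ (star (NormedSpace.exp Z))).comp
    (LinearMap.mulLeft ℂ (NormedSpace.exp Z))) (by simpa using hW) hY
  simpa using this

/-- If an eigenphase had ε|θ_j| ≥ π/2, then at time t = π/(2|θ_j|) ≤ ε the eigenvalue of exp(tX)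
would be ±i, at distance exactly √2 from 1. This is why all times up to ε enter the condition: at
time ε alone the phase could have wrapped around the circle. -/
theorem IsSmallStep.norm_smul_lt {X : Mat d} (hX : X ∈ uLie d) {ε : ℝ} (hε : 0 < ε)
    (h : IsSmallStep X ε) : ‖ε • X‖ < Real.pi / 2 := by
  obtain ⟨U, hU, θ, rfl⟩ := exists_eq_conj_diagonal hX
  rw [norm_smul, norm_conj_unitary hU, Matrix.l2_opNorm_diagonal, ← norm_smul,
    pi_norm_lt_iff (by positivity)]
  intro j
  by_contra! hj
  simp only [Pi.smul_apply, norm_smul, norm_mul, Complex.norm_real, Complex.norm_I, mul_one,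
    Real.norm_eq_abs, abs_of_pos hε] at hj
  have hpi := Real.pi_pos
  have hθ : 0 < |θ j| := by
    by_contra! h0
    have : |θ j| = 0 := le_antisymm h0 (abs_nonneg _)
    rw [this] at hj
    linarith
  have ht := h (Real.pi / 2 / |θ j|) ⟨by positivity, by rwa [div_le_iff₀ hθ]⟩
  change ‖_‖ < _ at ht
  have hone : (1 : Mat d) = U * Matrix.diagonal (fun _ => 1) * star U := by
    rw [Matrix.diagonal_one, mul_one, Matrix.mem_unitaryGroup_iff.1 hU]
  rw [exp_smul_conj_diagonal hU, hone, ← sub_mul, ← mul_sub] at ht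
  rw [Matrix.diagonal_sub] at ht
  erw [norm_conj_unitary hU, Matrix.l2_opNorm_diagonal] at ht
  have h1 := (norm_le_pi_norm _ j).trans_lt ht
  revert h1
  rw [imp_false, not_lt]
  have hcase : ((Real.pi / 2 / |θ j| : ℝ) : ℂ) * (θ j * Complex.I) = (Real.pi / 2) * Complex.I ∨
      ((Real.pi / 2 / |θ j| : ℝ) : ℂ) * (θ j * Complex.I) = -((Real.pi / 2) * Complex.I) := by
    have hne : (θ j : ℂ) ≠ 0 := by
      exact_mod_cast abs_pos.1 hθ
    rcases abs_choice (θ j) with h | h <;> rw [h] <;> push_cast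
    · left; field_simp
    · right; field_simp
  have hI : ‖Complex.I - 1‖ = √2 := by
    rw [Complex.norm_def, Complex.normSq_apply]; norm_num
  have hI' : ‖-Complex.I - 1‖ = √2 := by
    rw [Complex.norm_def, Complex.normSq_apply]; norm_num
  rcases hcase with h | h <;> rw [h]
  · rw [Complex.exp_pi_div_two_mul_I, hI]
  · rw [Complex.exp_neg, Complex.exp_pi_div_two_mul_I, Complex.inv_I, hI']

/-! ### Closed unitary groups and their one-parameter directions. -/

/-- A closed set of unitary matrices that is a group under multiplication. -/
structure IsClosedUnitary (H : Set (Mat d)) : Prop where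
  isClosed : IsClosed H
  unitary : ∀ A ∈ H, A ∈ Matrix.unitaryGroup (Fin d) ℂ
  one_mem : 1 ∈ H
  mul_mem : ∀ A ∈ H, ∀ B ∈ H, A * B ∈ H
  star_mem : ∀ A ∈ H, star A ∈ H

theorem IsClosedUnitary.pow_mem {H : Set (Mat d)} (hH : IsClosedUnitary H) {A : Mat d}
    (hA : A ∈ H) (n : ℕ) : A ^ n ∈ H := by
  induction n with
  | zero => simpa using hH.one_mem
  | succ n ih => rw [pow_succ]; exact hH.mul_mem _ ih _ hA

theorem IsClosedUnitary.inter_det {H : Set (Mat d)} (hH : IsClosedUnitary H) :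
    IsClosedUnitary (H ∩ {A | A.det = 1}) where
  isClosed := hH.isClosed.inter (isClosed_eq (continuous_id.matrix_det) continuous_const)
  unitary A hA := hH.unitary A hA.1
  one_mem := ⟨hH.one_mem, Matrix.det_one⟩
  mul_mem A hA B hB := ⟨hH.mul_mem A hA.1 B hB.1, by
    have h1 : A.det = 1 := hA.2
    have h2 : B.det = 1 := hB.2
    simp [Matrix.det_mul, h1, h2]⟩
  star_mem A hA := ⟨hH.star_mem A hA.1, by
    have h1 : A.det = 1 := hA.2
    change (star A).det = 1
    rw [Matrix.star_eq_conjTranspose, Matrix.det_conjTranspose, h1, star_one]⟩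

/-- Telescoping; multiplication by unitaries preserves the norm, so each factor contributes at most
‖A − B‖. -/
theorem norm_pow_sub_pow_le {A B : Mat d} (hA : A ∈ Matrix.unitaryGroup (Fin d) ℂ)
    (hB : B ∈ Matrix.unitaryGroup (Fin d) ℂ) (n : ℕ) : ‖A ^ n - B ^ n‖ ≤ n * ‖A - B‖ := by
  induction n with
  | zero => simp
  | succ n ih =>
    have h : A ^ (n + 1) - B ^ (n + 1) = A ^ n * (A - B) + (A ^ n - B ^ n) * B := by
      rw [pow_succ, pow_succ]; noncomm_ring
    rw [h]
    refine (norm_add_le _ _).trans ?_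
    rw [CStarRing.norm_mem_unitary_mul _ (Submonoid.pow_mem _ hA n),
      CStarRing.norm_mul_mem_unitary _ hB]
    push_cast
    linarith

theorem tendsto_smul_sub_of_hasDerivAt {f : ℝ → Mat d} {f' : Mat d} (hf : HasDerivAt f f' 0)
    {r : ℕ → ℝ} (hr : Tendsto r atTop atTop) :
    Tendsto (fun n => r n • (f (r n)⁻¹ - f 0)) atTop (𝓝 f') := by
  have h := hasDerivAt_iff_tendsto_slope_zero.1 hf
  have h2 : Tendsto (fun n => (r n)⁻¹) atTop (𝓝[≠] 0) :=
    tendsto_nhdsWithin_iff.2 ⟨tendsto_inv_atTop_zero.comp hr, by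
      filter_upwards [hr.eventually_gt_atTop 0] with n hn
      exact inv_ne_zero hn.ne'⟩
  refine (h.comp h2).congr fun n => ?_
  simp

theorem hasDerivAt_exp_smul_zero (X : Mat d) :
    HasDerivAt (fun t : ℝ => NormedSpace.exp (t • X)) X 0 := by
  have := hasDerivAt_exp_smul_const (𝕂 := ℝ) X (0 : ℝ)
  simpa using this

/-- Von Neumann's closed subgroup argument: g_n agrees with exp(X/r_n) up to o(1/r_n), so about
t·r_n factors give exp(tX) in the limit. -/
theorem exp_smul_mem_of_tendsto {H : Set (Mat d)} (hH : IsClosedUnitary H) {g : ℕ → Mat d}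
    (hg : ∀ n, g n ∈ H) {r : ℕ → ℝ} (hr : Tendsto r atTop atTop) {X : Mat d}
    (hX : Tendsto (fun n => r n • (g n - 1)) atTop (𝓝 X)) :
    X ∈ uLie d ∧ ∀ t : ℝ, NormedSpace.exp (t • X) ∈ H := by
  have hrpos := hr.eventually_gt_atTop 0
  have hg1 : Tendsto (fun n => g n - 1) atTop (𝓝 0) := by
    have := (tendsto_inv_atTop_zero.comp hr).smul hX
    rw [zero_smul] at this
    refine this.congr' ?_
    filter_upwards [hrpos] with n hn
    simp [smul_smul, inv_mul_cancel₀ hn.ne']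
  have hXu : X ∈ uLie d := by
    -- Unitarity reads (g − 1) + (g − 1)* = −(g − 1)(g − 1)*; the right side is of second order, so
    -- X + X* = 0.
    have h1 : Tendsto (fun n => r n • (g n - 1) + star (r n • (g n - 1))) atTop (𝓝 (X + star X)) :=
      hX.add hX.star
    have h2 : Tendsto (fun n => -(r n • (g n - 1) * star (g n - 1))) atTop
        (𝓝 (-(X * star 0))) := (hX.mul hg1.star).neg
    have h3 : X + star X = -(X * star 0) := by
      refine tendsto_nhds_unique h1 (h2.congr fun n => ?_)
      have hu := Matrix.mem_unitaryGroup_iff.1 (hH.unitary _ (hg n))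
      rw [star_smul, star_sub, star_one, star_trivial (r n), smul_mul_assoc, ← smul_neg, ← smul_add]
      congr 1
      rw [sub_mul, mul_sub, hu]
      noncomm_ring
    rw [star_zero, mul_zero, neg_zero] at h3
    exact eq_neg_of_add_eq_zero_right h3
  refine ⟨hXu, ?_⟩
  have hpos : ∀ t : ℝ, 0 ≤ t → NormedSpace.exp (t • X) ∈ H := by
    intro t ht
    set m : ℕ → ℕ := fun n => ⌊t * r n⌋₊
    have hm : Tendsto (fun n => (m n : ℝ) / r n) atTop (𝓝 t) :=
      (tendsto_nat_floor_mul_div_atTop ht).comp hr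
    set e : ℕ → Mat d := fun n => NormedSpace.exp ((r n)⁻¹ • X)
    have heu : ∀ n, e n ∈ Matrix.unitaryGroup (Fin d) ℂ := fun n =>
      exp_mem_unitaryGroup ((uLie d).smul_mem _ hXu)
    have he : Tendsto (fun n => r n • (e n - 1)) atTop (𝓝 X) := by
      have := tendsto_smul_sub_of_hasDerivAt (hasDerivAt_exp_smul_zero X) hr
      simpa using this
    have hem : Tendsto (fun n => e n ^ m n) atTop (𝓝 (NormedSpace.exp (t • X))) := by
      have hc : ContinuousAt (NormedSpace.exp : Mat d → Mat d) (t • X) :=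
        (NormedSpace.exp_analytic (𝕂 := ℂ) _).continuousAt
      have := hc.tendsto.comp (hm.smul_const X)
      refine this.congr fun n => ?_
      simp only [Function.comp, e]
      rw [← Matrix.exp_nsmul, ← Nat.cast_smul_eq_nsmul ℝ, smul_smul, div_eq_mul_inv]
    have hdiff : Tendsto (fun n => g n ^ m n - e n ^ m n) atTop (𝓝 0) := by
      have hb : Tendsto (fun n => (m n / r n) * ‖r n • (g n - 1) - r n • (e n - 1)‖) atTop
          (𝓝 (t * ‖X - X‖)) := hm.mul (hX.sub he).norm
      rw [sub_self, norm_zero, mul_zero] at hb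
      refine squeeze_zero_norm' ?_ hb
      filter_upwards [hrpos] with n hn
      refine (norm_pow_sub_pow_le (hH.unitary _ (hg n)) (heu n) _).trans (le_of_eq ?_)
      rw [← smul_sub, norm_smul, Real.norm_of_nonneg hn.le, sub_sub_sub_cancel_right]
      field_simp
    have hlim : Tendsto (fun n => g n ^ m n) atTop (𝓝 (NormedSpace.exp (t • X))) := by
      simpa using hdiff.add hem
    exact hH.isClosed.mem_of_tendsto hlim (Eventually.of_forall fun n => hH.pow_mem (hg n) _)
  intro t
  rcases le_total 0 t with ht | ht
  · exact hpos t ht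
  · have := hH.star_mem _ (hpos (-t) (neg_nonneg.2 ht))
    rwa [← exp_neg_eq_star ((uLie d).smul_mem _ hXu), neg_smul, neg_neg] at this

/-- The directions of the one-parameter groups contained in a closed group of unitary matrices. -/
def tangent {H : Set (Mat d)} (hH : IsClosedUnitary H) : Submodule ℝ (Mat d) where
  carrier := {X | X ∈ uLie d ∧ ∀ t : ℝ, NormedSpace.exp (t • X) ∈ H}
  zero_mem' := ⟨(uLie d).zero_mem, fun t => by simpa using hH.one_mem⟩
  smul_mem' r X hX := ⟨(uLie d).smul_mem r hX.1, fun t => by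
    rw [smul_smul]; exact hX.2 _⟩
  add_mem' {X Y} hX hY := by
    have hr : Tendsto (fun n : ℕ => (n : ℝ)) atTop atTop := tendsto_natCast_atTop_atTop
    -- The curve exp(tX) exp(tY) has derivative X + Y at 0.
    refine exp_smul_mem_of_tendsto hH (g := fun n : ℕ => NormedSpace.exp ((n : ℝ)⁻¹ • X) *
      NormedSpace.exp ((n : ℝ)⁻¹ • Y)) (fun n => hH.mul_mem _ (hX.2 _) _ (hY.2 _)) hr ?_
    have hd := (hasDerivAt_exp_smul_zero X).mul (hasDerivAt_exp_smul_zero Y)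
    have := tendsto_smul_sub_of_hasDerivAt hd hr
    simpa using this

theorem conj_mem_tangent {H : Set (Mat d)} (hH : IsClosedUnitary H) {A X : Mat d} (hA : A ∈ H)
    (hX : X ∈ tangent hH) : A * X * star A ∈ tangent hH := by
  refine ⟨?_, fun t => ?_⟩
  · have h : star X = -X := hX.1
    change star (A * X * star A) = -(A * X * star A)
    rw [star_mul, star_mul, star_star, h]
    noncomm_ring
  · rw [← Matrix.smul_mul, ← Matrix.mul_smul, exp_conj_unitary (hH.unitary A hA)]
    exact hH.mul_mem _ (hH.mul_mem _ hA _ (hX.2 t)) _ (hH.star_mem _ hA)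

end Analysis

/-! ### Nonscalar directions from iterated commutators. -/

section Commutators

open Filter Topology
open scoped Matrix.Norms.L2Operator

variable {d : ℕ}

theorem norm_apply_le_l2_opNorm (A : Mat d) (i j : Fin d) : ‖A i j‖ ≤ ‖A‖ := by
  have h := Matrix.l2_opNorm_mulVec A (EuclideanSpace.single j (1 : ℂ))
  rw [PiLp.norm_single, norm_one, mul_one] at h
  refine le_trans ?_ h
  have h2 := PiLp.norm_apply_le (WithLp.toLp 2 (A.mulVec (Pi.single j (1 : ℂ)))) i
  simpa using h2

theorem mul_comm_of_isDiag {A B : Mat d} (hA : A.IsDiag) (hB : B.IsDiag) : A * B = B * A := by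
  rw [← hA.diagonal_diag, ← hB.diagonal_diag, Matrix.diagonal_mul_diagonal,
    Matrix.diagonal_mul_diagonal]
  congr 1
  funext i
  exact mul_comm _ _

/-- The group commutator `A B A* B*` of unitary matrices. -/
def groupComm (A B : Mat d) : Mat d := A * B * star A * star B

theorem det_groupComm {A B : Mat d} (hA : A ∈ Matrix.unitaryGroup (Fin d) ℂ)
    (hB : B ∈ Matrix.unitaryGroup (Fin d) ℂ) : (groupComm A B).det = 1 := by
  have h1 := congrArg Matrix.det (Matrix.mem_unitaryGroup_iff.1 hA)
  have h2 := congrArg Matrix.det (Matrix.mem_unitaryGroup_iff.1 hB)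
  rw [Matrix.det_mul, Matrix.det_one] at h1 h2
  rw [groupComm, Matrix.det_mul, Matrix.det_mul, Matrix.det_mul]
  linear_combination B.det * (star B).det * h1 + h2

/-- AB − BA = [A − 1, B − 1], so a commutator is small to second order. -/
theorem norm_groupComm_sub_one_le {A B : Mat d} (hA : A ∈ Matrix.unitaryGroup (Fin d) ℂ)
    (hB : B ∈ Matrix.unitaryGroup (Fin d) ℂ) :
    ‖groupComm A B - 1‖ ≤ 2 * ‖A - 1‖ * ‖B - 1‖ := by
  have h1 := Matrix.mem_unitaryGroup_iff.1 hA
  have h2 := Matrix.mem_unitaryGroup_iff.1 hB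
  have h : groupComm A B - 1 =
      ((A - 1) * (B - 1) - (B - 1) * (A - 1)) * (star A * star B) := by
    have : (A - 1) * (B - 1) - (B - 1) * (A - 1) = A * B - B * A := by noncomm_ring
    rw [this, sub_mul, groupComm]
    congr 1
    · simp only [mul_assoc]
    · rw [mul_assoc, ← mul_assoc A, h1, one_mul, h2]
  rw [h, CStarRing.norm_mul_mem_unitary _
    (mul_mem (star_mem_unitaryGroup hA) (star_mem_unitaryGroup hB))]
  refine (norm_sub_le _ _).trans ?_
  have h3 := norm_mul_le (A - 1) (B - 1)
  have h4 := norm_mul_le (B - 1) (A - 1)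
  linarith

/-- If the commutator is diag(e), then a_i C_{ij} = e_i C_{ij} a_j. The diagonal entries of C are
nonzero because C is close to 1, so a_i = e_i a_i; a nonzero C_{ij} with i ≠ j would also give a_i =
e_i a_j, hence a_i = a_j. -/
theorem isDiag_of_isDiag_groupComm {a : Fin d → ℂ} (ha : Function.Injective a)
    {C : Mat d} (hA : Matrix.diagonal a ∈ Matrix.unitaryGroup (Fin d) ℂ)
    (hC : C ∈ Matrix.unitaryGroup (Fin d) ℂ) (hC1 : ‖C - 1‖ < 1)
    (h : (groupComm (Matrix.diagonal a) C).IsDiag) : C.IsDiag := by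
  obtain ⟨e, he⟩ : ∃ e, groupComm (Matrix.diagonal a) C = Matrix.diagonal e :=
    ⟨_, h.diagonal_diag.symm⟩
  have hdiag : ∀ j, C j j ≠ 0 := by
    intro j hj
    have := (norm_apply_le_l2_opNorm (C - 1) j j).trans_lt hC1
    simp [hj] at this
  have key : Matrix.diagonal a * C = Matrix.diagonal e * C * Matrix.diagonal a := by
    have h1 := Matrix.mem_unitaryGroup_iff'.1 hA
    have h2 := Matrix.mem_unitaryGroup_iff'.1 hC
    rw [← he, groupComm, mul_assoc _ (star C), h2, mul_one, mul_assoc _ (star _), h1, mul_one]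
  have hent : ∀ i j, a i * C i j = e i * C i j * a j := by
    intro i j
    have := congrFun (congrFun key i) j
    simpa [Matrix.mul_diagonal, Matrix.diagonal_mul] using this
  have he1 : ∀ i, a i = e i * a i := fun i => by
    have := hent i i
    exact mul_right_cancel₀ (hdiag i) (by linear_combination this)
  intro i j hij
  have h1 := hent i j
  by_contra hne
  have h2 : a i = e i * a j := mul_right_cancel₀ hne (by linear_combination h1)
  have hai : a i ≠ 0 := by
    have hd := Matrix.UnitaryGroup.det_isUnit ⟨_, hA⟩
    rw [Matrix.det_diagonal] at hd
    exact Finset.prod_ne_zero_iff.1 hd.ne_zero i (Finset.mem_univ i)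
  have hei : e i ≠ 0 := fun h0 => hai (by rw [h2, h0, zero_mul])
  exact hij (ha (mul_left_cancel₀ hei ((he1 i).symm.trans h2)))

/-- Iterating B ↦ ABA*B* at least halves the distance to 1 each time, yet never produces a diagonal
matrix, in particular never 1. By compactness the normalized differences from 1 accumulate at a unit
vector, which is tangent to H ∩ {det = 1}. -/
theorem exists_mem_tangent_trace_eq_zero {H : Set (Mat d)} (hH : IsClosedUnitary H)
    {a : Fin d → ℂ} (ha : Function.Injective a) (hA : Matrix.diagonal a ∈ H)
    (hA1 : ‖Matrix.diagonal a - (1 : Mat d)‖ ≤ 1 / 4) {B : Mat d} (hB : B ∈ H)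
    (hB1 : ‖B - 1‖ < 1) (hBd : ¬ B.IsDiag) :
    ∃ X ∈ tangent hH, X.trace = 0 ∧ X ≠ 0 := by
  set A : Mat d := Matrix.diagonal a with hAdef
  have hAu := hH.unitary A hA
  let b : ℕ → Mat d := fun n => (groupComm A)^[n] B
  have hb : ∀ n, b (n + 1) = groupComm A (b n) := fun n => Function.iterate_succ_apply' _ _ _
  have hbH : ∀ n, b n ∈ H := by
    intro n
    induction n with
    | zero => exact hB
    | succ n ih =>
      rw [hb]
      exact hH.mul_mem _ (hH.mul_mem _ (hH.mul_mem _ hA _ ih) _ (hH.star_mem _ hA)) _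
        (hH.star_mem _ ih)
  have hbu := fun n => hH.unitary _ (hbH n)
  have hbn : ∀ n, ‖b n - 1‖ ≤ (1 / 2 : ℝ) ^ n * ‖B - 1‖ := by
    intro n
    induction n with
    | zero => simp [b]
    | succ n ih =>
      rw [hb]
      refine (norm_groupComm_sub_one_le hAu (hbu n)).trans ?_
      calc 2 * ‖A - 1‖ * ‖b n - 1‖ ≤ 2 * (1 / 4) * ((1 / 2 : ℝ) ^ n * ‖B - 1‖) := by gcongr
        _ = _ := by ring
  have hbn1 : ∀ n, ‖b n - 1‖ < 1 := fun n => by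
    refine (hbn n).trans_lt (lt_of_le_of_lt ?_ hB1)
    exact mul_le_of_le_one_left (norm_nonneg _) (pow_le_one₀ (by norm_num) (by norm_num))
  have hbd : ∀ n, ¬ (b n).IsDiag := by
    intro n
    induction n with
    | zero => exact hBd
    | succ n ih =>
      rw [hb]
      exact fun h => ih (isDiag_of_isDiag_groupComm ha hAu (hbu n) (hbn1 n) h)
  have hpos : ∀ n, 0 < ‖b n - 1‖ := fun n => by
    rw [norm_pos_iff, sub_ne_zero]
    intro h
    exact hbd n (by rw [h]; exact Matrix.isDiag_one)
  -- The index shift drops B itself, so that every term is a commutator and has determinant 1.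
  let g : ℕ → Mat d := fun n => b (n + 1)
  have hg0 : Tendsto (fun n => ‖g n - 1‖) atTop (𝓝 0) := by
    have h1 : Tendsto (fun n : ℕ => (1 / 2 : ℝ) ^ n * ‖B - 1‖) atTop (𝓝 (0 * ‖B - 1‖)) :=
      (tendsto_pow_atTop_nhds_zero_of_lt_one (by norm_num) (by norm_num)).mul_const _
    rw [zero_mul] at h1
    exact (squeeze_zero (fun n => norm_nonneg _) hbn h1).comp (tendsto_add_atTop_nat 1)
  have hr : Tendsto (fun n => ‖g n - 1‖⁻¹) atTop atTop :=
    (tendsto_nhdsWithin_iff.2 ⟨hg0, Eventually.of_forall fun n => hpos (n + 1)⟩ :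
      Tendsto _ _ (𝓝[>] (0 : ℝ))).inv_tendsto_nhdsGT_zero
  have hs : ∀ n, ‖g n - 1‖⁻¹ • (g n - 1) ∈ Metric.sphere (0 : Mat d) 1 := fun n => by
    rw [mem_sphere_zero_iff_norm, norm_smul, norm_inv, norm_norm, inv_mul_cancel₀ (hpos _).ne']
  have : ProperSpace (Mat d) := FiniteDimensional.proper ℂ _
  obtain ⟨X, hX, φ, hφ, hlim⟩ := (isCompact_sphere (0 : Mat d) 1).tendsto_subseq hs
  have hgH : ∀ n, g (φ n) ∈ H ∩ {A | A.det = 1} := fun n =>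
    ⟨hbH _, by change (b (φ n + 1)).det = 1; rw [hb]; exact det_groupComm hAu (hbu _)⟩
  obtain ⟨hXu, hXt⟩ := exp_smul_mem_of_tendsto hH.inter_det hgH (hr.comp hφ.tendsto_atTop) hlim
  refine ⟨X, ⟨hXu, fun t => (hXt t).1⟩, ?_, ?_⟩
  · have hdet : ∀ t : ℝ, Complex.exp (t * X.trace) = 1 := fun t => by
      have h1 : (NormedSpace.exp (t • X)).det = 1 := (hXt t).2
      rw [det_exp_of_mem_uLie ((uLie d).smul_mem t hXu), Matrix.trace_smul] at h1
      simpa using h1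
    rw [trace_eq_im_mul_I hXu] at hdet ⊢
    set τ := X.trace.im
    by_contra hne
    have hτ : τ ≠ 0 := fun h0 => hne (by rw [h0]; simp)
    -- At this time a nonzero trace iτ would give determinant −1.
    have h1 := hdet (Real.pi / τ)
    have h2 : ((Real.pi / τ : ℝ) : ℂ) * (τ * Complex.I) = Real.pi * Complex.I := by
      have : (τ : ℂ) ≠ 0 := by exact_mod_cast hτ
      push_cast
      field_simp
    rw [h2, Complex.exp_pi_mul_I] at h1
    norm_num at h1
  · rintro rfl
    simp at hX

/-- The two step lengths are independent: once H contains the full diagonal torus, s can be chosen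
at will, whereas otherwise s = ε. -/
theorem suLie_le_tangent {H : Set (Mat d)} (hH : IsClosedUnitary H) {x : Fin d → ℂ}
    (hx : IsSidon x) (hxu : Matrix.diagonal x ∈ uLie d) {c : Fin (d - 1) → ℝ}
    (hc : ∀ j, c j ≠ 0) {s ε : ℝ} (hs : 0 < s) (hε : 0 < ε)
    (h1 : NormedSpace.exp (s • Matrix.diagonal x) ∈ H)
    (h2 : NormedSpace.exp (ε • chain d c) ∈ H)
    (h1n : ‖s • (Matrix.diagonal x : Mat d)‖ < Real.pi / 2)
    (h2n : ‖ε • chain d c‖ < Real.pi / 2)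
    {Y : Mat d} (hY : Y ∈ tangent hH) (hYs : ∀ z : ℂ, Y ≠ z • 1) {Z : Mat d}
    (hZ : Z ∈ suLie d) : Z ∈ tangent hH := by
  have hlie : ∀ (X : Mat d) (r : ℝ), X ∈ uLie d → 0 < r → NormedSpace.exp (r • X) ∈ H →
      ‖r • X‖ < Real.pi / 2 → ∀ Y ∈ tangent hH, ⁅X, Y⁆ ∈ tangent hH := by
    intro X r hX hr hm hn Y hY
    have := lie_mem_of_exp_conj_mem_real (tangent hH) (fun A hA => hA.1)
      ((uLie d).smul_mem r hX) hn (fun Y hY => conj_mem_tangent hH hm hY) hY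
    have h3 := (tangent hH).smul_mem r⁻¹ this
    convert h3 using 1
    rw [Ring.lie_def, Ring.lie_def, smul_mul_assoc, mul_smul_comm, ← smul_sub, smul_smul,
      inv_mul_cancel₀ hr.ne', one_smul]
  exact suLie_le_of_lie_mem (V := tangent hH) (fun A hA => hA.1) hx hc (hlie _ s hxu hs h1 h1n)
    (hlie _ ε (chain_mem_suLie d c).1 hε h2 h2n) hY hYs hZ

/-- A diagonal exponential would fix diag x under conjugation, so the commutator with the chain
would preserve the line through diag x. Its entry (0, 1) is a nonzero multiple of c₀(x₁ − x₀), while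
that line is diagonal. -/
theorem not_isDiag_exp_smul_chain (hd : 2 ≤ d) {x : Fin d → ℂ} (hx : IsSidon x)
    {c : Fin (d - 1) → ℝ} (hc : ∀ j, c j ≠ 0) {ε : ℝ} (hε : 0 < ε)
    (hn : ‖ε • chain d c‖ < Real.pi / 2) : ¬ (NormedSpace.exp (ε • chain d c)).IsDiag := by
  intro h
  have hu := (uLie d).smul_mem ε (chain_mem_suLie d c).1
  have hunit := Matrix.mem_unitaryGroup_iff.1 (exp_mem_unitaryGroup hu)
  set B := NormedSpace.exp (ε • chain d c)
  have hcomm : B * Matrix.diagonal x * star B = Matrix.diagonal x := by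
    have := mul_comm_of_isDiag h (Matrix.isDiag_diagonal x)
    rw [this, mul_assoc, hunit, mul_one]
  have hmem := lie_mem_of_exp_conj_mem (Submodule.span ℂ {Matrix.diagonal x}) hu hn (by
    intro Y hY
    obtain ⟨z, rfl⟩ := Submodule.mem_span_singleton.1 hY
    change B * _ * star B ∈ _
    rw [mul_smul_comm, smul_mul_assoc, hcomm]
    exact hY) (Submodule.mem_span_singleton_self _)
  obtain ⟨z, hz⟩ := Submodule.mem_span_singleton.1 hmem
  have hj : 0 < d - 1 := by omega
  have h0 := congrFun (congrFun hz ⟨0, by omega⟩) ⟨1, by omega⟩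
  rw [← lie_skew, lie_diagonal] at h0
  have hch : chain d c ⟨0, by omega⟩ ⟨1, by omega⟩ = c ⟨0, hj⟩ :=
    (chain_apply_succ c ⟨0, hj⟩).1
  simp [hch, hε.ne', hc, sub_eq_zero] at h0
  exact hx.ne (by simp) h0

theorem suLie_le_tangent_of_small {H : Set (Mat d)} (hH : IsClosedUnitary H) {x : Fin d → ℂ}
    (hx : IsSidon x) (hxu : Matrix.diagonal x ∈ uLie d) {c : Fin (d - 1) → ℝ}
    (hc : ∀ j, c j ≠ 0) {ε : ℝ} (hε : 0 < ε)
    (h1 : NormedSpace.exp (ε • Matrix.diagonal x) ∈ H)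
    (h2 : NormedSpace.exp (ε • chain d c) ∈ H)
    (h1n : ‖ε • (Matrix.diagonal x : Mat d)‖ < Real.pi / 2)
    (h2n : ‖ε • chain d c‖ < Real.pi / 2)
    (h1' : ‖NormedSpace.exp (ε • (Matrix.diagonal x : Mat d)) - 1‖ ≤ 1 / 4)
    (h2' : ‖NormedSpace.exp (ε • chain d c) - 1‖ < 1) {Z : Mat d}
    (hZ : Z ∈ suLie d) : Z ∈ tangent hH := by
  rcases lt_or_ge d 2 with hd | hd
  · rw [eq_zero_of_mem_suLie hd hZ]
    exact (tangent hH).zero_mem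
  have hexp : NormedSpace.exp (ε • (Matrix.diagonal x : Mat d)) =
      Matrix.diagonal fun j => Complex.exp (ε * x j) := by
    rw [← Matrix.diagonal_smul, exp_diagonal]
    simp
  -- The exponents have imaginary parts below π/2 in absolute value, where exp is injective.
  have hinj : Function.Injective fun j => Complex.exp (ε * x j) := by
    have him : ∀ j, |((ε : ℂ) * x j).im| < Real.pi / 2 := fun j => by
      rw [← Matrix.diagonal_smul, Matrix.l2_opNorm_diagonal] at h1n
      refine (Complex.abs_im_le_norm _).trans_lt (lt_of_le_of_lt ?_ h1n)
      simpa using norm_le_pi_norm (ε • x) j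
    intro j k hjk
    have hpi := Real.pi_pos
    have hj := abs_lt.1 (him j)
    have hk := abs_lt.1 (him k)
    have := Complex.exp_inj_of_neg_pi_lt_of_le_pi (by linarith) (by linarith) (by linarith)
      (by linarith) hjk
    by_contra hne
    exact hx.ne hne (mul_left_cancel₀ (by exact_mod_cast hε.ne') this)
  obtain ⟨X, hX, htr, hX0⟩ := exists_mem_tangent_trace_eq_zero hH hinj (hexp ▸ h1) (hexp ▸ h1')
    h2 h2' (not_isDiag_exp_smul_chain hd hx hc hε h2n)
  refine suLie_le_tangent hH hx hxu hc hε hε h1 h2 h1n h2n hX ?_ hZ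
  rintro z rfl
  rw [Matrix.trace_smul, Matrix.trace_one, smul_eq_mul, mul_eq_zero] at htr
  rcases htr with h | h
  · exact hX0 (by rw [h, zero_smul])
  · simp at h
    omega

theorem suLie_le_tangent_of_exp_smul_mem {H : Set (Mat d)} (hH : IsClosedUnitary H)
    {x : Fin d → ℂ} (hx : IsSidon x) (hxu : Matrix.diagonal x ∈ uLie d) {c : Fin (d - 1) → ℝ}
    (hc : ∀ j, c j ≠ 0) {ε : ℝ} (hε : 0 < ε)
    (h1 : ∀ s : ℝ, NormedSpace.exp (s • Matrix.diagonal x) ∈ H)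
    (h2 : NormedSpace.exp (ε • chain d c) ∈ H) (h2n : IsSmallStep (chain d c) ε) {Z : Mat d}
    (hZ : Z ∈ suLie d) : Z ∈ tangent hH := by
  rcases lt_or_ge d 2 with hd | hd
  · rw [eq_zero_of_mem_suLie hd hZ]
    exact (tangent hH).zero_mem
  have hpi := Real.pi_pos
  -- With every s available, this scaling brings the norm below 1 < π/2.
  have hs : ‖(‖(Matrix.diagonal x : Mat d)‖ + 1)⁻¹ • (Matrix.diagonal x : Mat d)‖ <
      Real.pi / 2 := by
    have h0 := norm_nonneg (Matrix.diagonal x : Mat d)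
    rw [norm_smul, norm_inv, Real.norm_of_nonneg (by positivity), inv_mul_lt_iff₀ (by positivity)]
    nlinarith [Real.pi_gt_three]
  exact suLie_le_tangent hH hx hxu hc (by positivity) hε (h1 _) h2 hs
    (h2n.norm_smul_lt (chain_mem_suLie d c).1 hε) (Y := Matrix.diagonal x) ⟨hxu, h1⟩
    (hx.diagonal_ne_smul_one hd) hZ

/-- The smallness conditions on the step hold for all small positive steps. -/
theorem exists_step_bound (A B : Mat d) : ∃ ε₀ : ℝ, 0 < ε₀ ∧ ∀ ε ∈ Ioo 0 ε₀,
    ‖ε • A‖ < Real.pi / 2 ∧ ‖ε • B‖ < Real.pi / 2 ∧ ‖NormedSpace.exp (ε • A) - 1‖ ≤ 1 / 4 ∧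
      ‖NormedSpace.exp (ε • B) - 1‖ < 1 := by
  have hlin : ∀ X : Mat d, Tendsto (fun ε : ℝ => ‖ε • X‖) (𝓝 0) (𝓝 0) := fun X => by
    have : Continuous fun ε : ℝ => ‖ε • X‖ := by fun_prop
    simpa using this.tendsto 0
  have hexp : ∀ X : Mat d, Tendsto (fun ε : ℝ => ‖NormedSpace.exp (ε • X) - 1‖) (𝓝 0) (𝓝 0) :=
    fun X => by
      have h1 : ContinuousAt (fun _ : ℝ => (1 : Mat d)) 0 := continuousAt_const
      have := ((hasDerivAt_exp_smul_zero X).continuousAt.sub h1).norm.tendsto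
      simpa using this
  have hpi : (0 : ℝ) < Real.pi / 2 := by positivity
  have hev := ((hlin A).eventually (gt_mem_nhds hpi)).and
    (((hlin B).eventually (gt_mem_nhds hpi)).and
    (((hexp A).eventually (gt_mem_nhds (show (0 : ℝ) < 1 / 4 by norm_num))).and
      ((hexp B).eventually (gt_mem_nhds one_pos))))
  obtain ⟨ε₀, hε₀, h⟩ := Metric.eventually_nhds_iff.1 hev
  refine ⟨ε₀, hε₀, fun ε hε => ?_⟩
  obtain ⟨h1, h2, h3, h4⟩ := h (y := ε) (by
    rw [Real.dist_eq, sub_zero, abs_of_pos hε.1]; exact hε.2)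
  exact ⟨h1, h2, h3.le, h4⟩

end Commutators

/-! ### Surjectivity of exp, the diagonal torus and determinants. -/

section Torus

open Filter Topology
open scoped Matrix.Norms.L2Operator

variable {d : ℕ}

theorem exists_exp_eq {u : Mat d} (hu : u ∈ Matrix.unitaryGroup (Fin d) ℂ) :
    ∃ A ∈ uLie d, NormedSpace.exp A = u := by
  set B : Mat d := cfc (fun z : ℂ => (z.arg : ℂ)) u
  have hu' : u ∈ unitary (Mat d) := hu
  have hnorm : IsStarNormal u := ⟨by
    rw [Commute, SemiconjBy, (Unitary.mem_iff.1 hu').1, (Unitary.mem_iff.1 hu').2]⟩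
  -- The spectrum is finite, so the branch cut of `arg` does not obstruct the functional calculus.
  have hcont : ∀ f : ℂ → ℂ, ContinuousOn f (spectrum ℂ u) := fun f => by
    have hfin : (spectrum ℂ u).Finite := Matrix.finite_spectrum u
    exact hfin.continuousOn f
  have hB : star B = B := IsSelfAdjoint.cfc_arg u
  refine ⟨Complex.I • B, ?_, ?_⟩
  · change star (Complex.I • B) = -(Complex.I • B)
    rw [star_smul, hB]
    simp
  · rw [← CFC.exp_eq_normedSpace_exp (𝕜 := ℂ), ← cfc_comp_smul Complex.I _ B (by
        exact (Continuous.continuousOn (by fun_prop))) , ← cfc_comp' _ _ _ (by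
        exact (Continuous.continuousOn (by fun_prop))) (hcont _)]
    conv_rhs => rw [← cfc_id' ℂ u]
    refine cfc_congr fun y hy => ?_
    have hy₁ : ‖y‖ = 1 := spectrum.norm_eq_one_of_unitary hu' hy
    have h1 : Complex.I * y.arg = Complex.log y :=
      Complex.ext (by simp [Complex.log_re, hy₁]) (by simp [Complex.log_im])
    have hy0 : y ≠ 0 := fun h => by simp [h] at hy₁
    simpa [← Complex.exp_eq_exp_ℂ, h1] using Complex.exp_log hy0

/-- The diagonal unitary matrix with phases `θ`. -/
noncomputable def phase (θ : Fin d → ℝ) : Mat d :=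
  Matrix.diagonal fun j => Complex.exp (θ j * Complex.I)

theorem exp_diagonal_mul_I (θ : Fin d → ℝ) :
    NormedSpace.exp (Matrix.diagonal fun j => (θ j : ℂ) * Complex.I : Mat d) = phase θ :=
  exp_diagonal _

theorem smul_diagonal_mul_I (s : ℝ) (θ : Fin d → ℝ) :
    s • (Matrix.diagonal fun j => (θ j : ℂ) * Complex.I : Mat d) =
      Matrix.diagonal fun j => ((s • θ) j : ℂ) * Complex.I := by
  rw [← Matrix.diagonal_smul]
  congr 1
  funext j
  simp [mul_assoc]

theorem diagonal_mul_I_mem_uLie (θ : Fin d → ℝ) :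
    Matrix.diagonal (fun j => (θ j : ℂ) * Complex.I) ∈ uLie d := by
  rw [mem_uLie, Matrix.diagonal_conjTranspose, Matrix.diagonal_neg]
  congr 1
  funext j
  simp

theorem trace_diagonal_mul_I (θ : Fin d → ℝ) :
    (Matrix.diagonal fun j => (θ j : ℂ) * Complex.I).trace = (∑ j, θ j : ℝ) * Complex.I := by
  rw [Matrix.trace_diagonal, ← Finset.sum_mul]
  push_cast
  rfl

theorem exists_eq_diagonal_mul_I {A : Mat d} (hA : A ∈ uLie d) (hd : A.IsDiag) :
    ∃ θ : Fin d → ℝ, A = Matrix.diagonal fun j => (θ j : ℂ) * Complex.I := by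
  refine ⟨fun j => (A j j).im, ?_⟩
  conv_lhs => rw [← hd.diagonal_diag]
  congr 1
  funext j
  have h := congrArg Complex.re (congrFun (congrFun (mem_uLie.1 hA) j) j)
  simp at h
  apply Complex.ext
  · simp; linarith
  · simp

theorem phase_mem_unitaryGroup (θ : Fin d → ℝ) : phase θ ∈ Matrix.unitaryGroup (Fin d) ℂ := by
  rw [← exp_diagonal_mul_I]
  exact exp_mem_unitaryGroup (diagonal_mul_I_mem_uLie θ)

theorem phase_pow (θ : Fin d → ℝ) (n : ℕ) : phase θ ^ n = phase ((n : ℝ) • θ) := by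
  rw [phase, Matrix.diagonal_pow, phase]
  congr 1
  funext j
  rw [Pi.pow_apply, ← Complex.exp_nat_mul]
  simp [mul_assoc]

theorem det_phase (θ : Fin d → ℝ) : (phase θ).det = Complex.exp ((∑ j, θ j : ℝ) * Complex.I) := by
  rw [← exp_diagonal_mul_I, det_exp_of_mem_uLie (diagonal_mul_I_mem_uLie θ), trace_diagonal_mul_I]

theorem continuous_phase : Continuous (phase : (Fin d → ℝ) → Mat d) := by
  unfold phase
  fun_prop

/-- The sum of the phases is 2πn, which can be subtracted from a single phase without changing the
matrix. -/
theorem exists_sum_eq_zero_of_det_phase {θ : Fin d → ℝ} (h : (phase θ).det = 1) :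
    ∃ η : Fin d → ℝ, ∑ j, η j = 0 ∧ phase η = phase θ := by
  rw [det_phase, Complex.exp_eq_one_iff] at h
  obtain ⟨n, hn⟩ := h
  have hsum : ∑ j, θ j = n * (2 * Real.pi) := by
    have h1 : ((∑ j, θ j : ℝ) : ℂ) * Complex.I = (n * (2 * Real.pi) : ℝ) * Complex.I := by
      rw [hn]; push_cast; ring
    exact_mod_cast mul_right_cancel₀ Complex.I_ne_zero h1
  rcases isEmpty_or_nonempty (Fin d) with he | ⟨⟨i⟩⟩
  · exact ⟨θ, by simp, rfl⟩
  refine ⟨θ - Pi.single i (n * (2 * Real.pi)), ?_, ?_⟩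
  · simp [Finset.sum_sub_distrib, hsum]
  · rw [phase, phase]
    congr 1
    funext j
    by_cases hj : j = i
    · subst hj
      rw [Complex.exp_eq_exp_iff_exists_int]
      refine ⟨-n, ?_⟩
      simp
      ring
    · simp [hj]

theorem exists_phase_eq_of_isDiag {A : Mat d} (hA : A ∈ Matrix.unitaryGroup (Fin d) ℂ)
    (hd : A.IsDiag) : ∃ θ : Fin d → ℝ, A = phase θ := by
  refine ⟨fun j => (A j j).arg, ?_⟩
  have h := Matrix.mem_unitaryGroup_iff.1 hA
  rw [← hd.diagonal_diag] at h ⊢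
  rw [phase]
  congr 1
  funext j
  have h1 := congrFun (congrFun h j) j
  rw [Matrix.star_eq_conjTranspose, Matrix.diagonal_conjTranspose, Matrix.diagonal_mul_diagonal,
    Matrix.diagonal_apply_eq, Matrix.one_apply_eq] at h1
  have h2 : ‖A j j‖ = 1 := by
    have h3 : A j j * (starRingEnd ℂ) (A j j) = 1 := h1
    rw [Complex.mul_conj, Complex.normSq_eq_norm_sq] at h3
    have h4 : ‖A j j‖ ^ 2 = 1 := by exact_mod_cast h3
    exact (pow_eq_one_iff_of_nonneg (norm_nonneg _) two_ne_zero).1 h4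
  have h5 := Complex.norm_mul_exp_arg_mul_I (A j j)
  rw [h2] at h5
  simpa using h5.symm

theorem exists_suLie_exp_eq {u : Mat d} (hu : u ∈ Matrix.specialUnitaryGroup (Fin d) ℂ) :
    ∃ A ∈ suLie d, NormedSpace.exp A = u := by
  obtain ⟨hu1, hu2⟩ := Matrix.mem_specialUnitaryGroup_iff.1 hu
  obtain ⟨B, hB, rfl⟩ := exists_exp_eq hu1
  obtain ⟨U, hU, θ, rfl⟩ := exists_eq_conj_diagonal hB
  have hUdet : U.det * (star U).det = 1 := by
    rw [← Matrix.det_mul, Matrix.mem_unitaryGroup_iff.1 hU, Matrix.det_one]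
  rw [exp_conj_unitary hU, exp_diagonal_mul_I] at hu2 ⊢
  have hdet : (phase θ).det = 1 := by
    rw [Matrix.det_mul, Matrix.det_mul] at hu2
    linear_combination hu2 - (phase θ).det * hUdet
  obtain ⟨η, hη, hηθ⟩ := exists_sum_eq_zero_of_det_phase hdet
  refine ⟨U * Matrix.diagonal (fun j => (η j : ℂ) * Complex.I) * star U, ⟨?_, ?_⟩, ?_⟩
  · have h : star (Matrix.diagonal (fun j => (η j : ℂ) * Complex.I)) =
        -Matrix.diagonal (fun j => (η j : ℂ) * Complex.I) := diagonal_mul_I_mem_uLie η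
    change star (U * Matrix.diagonal (fun j => (η j : ℂ) * Complex.I) * star U) = -_
    rw [star_mul, star_mul, star_star, h]
    noncomm_ring
  · rw [Matrix.trace_mul_cycle, Matrix.mem_unitaryGroup_iff'.1 hU, one_mul,
      trace_diagonal_mul_I, hη]
    simp
  · rw [exp_conj_unitary hU, exp_diagonal_mul_I, hηθ]

theorem specialUnitary_mem_of_suLie_le_tangent {H : Set (Mat d)} (hH : IsClosedUnitary H)
    (h : ∀ Z ∈ suLie d, Z ∈ tangent hH) {u : Mat d}
    (hu : u ∈ Matrix.specialUnitaryGroup (Fin d) ℂ) : u ∈ H := by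
  obtain ⟨A, hA, rfl⟩ := exists_suLie_exp_eq hu
  simpa using (h A hA).2 1

/-- Dividing u by an element of H with the same determinant leaves a matrix in SU(d). -/
theorem unitary_mem_of_suLie_le_tangent {H : Set (Mat d)} (hH : IsClosedUnitary H)
    (h : ∀ Z ∈ suLie d, Z ∈ tangent hH)
    (hdet : ∀ φ : ℝ, ∃ A ∈ H, A.det = Complex.exp (φ * Complex.I)) {u : Mat d}
    (hu : u ∈ Matrix.unitaryGroup (Fin d) ℂ) : u ∈ H := by
  obtain ⟨B, hB, hBu⟩ := exists_exp_eq hu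
  obtain ⟨A, hA, hAdet⟩ := hdet B.trace.im
  have hAu := hH.unitary A hA
  have hAA := Matrix.mem_unitaryGroup_iff.1 hAu
  have h1 : star A * u ∈ H := specialUnitary_mem_of_suLie_le_tangent hH h (by
    refine Matrix.mem_specialUnitaryGroup_iff.2 ⟨mul_mem (star_mem_unitaryGroup hAu) hu, ?_⟩
    have h2 := congrArg Matrix.det hAA
    rw [Matrix.det_mul, Matrix.det_one] at h2
    rw [Matrix.det_mul, ← hBu, det_exp_of_mem_uLie hB, trace_eq_im_mul_I hB, ← hAdet, mul_comm]
    exact h2)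
  have h3 := hH.mul_mem A hA _ h1
  rwa [← mul_assoc, hAA, one_mul] at h3

/-- A coincidence α_j − α_k = α_l − α_m makes the character f trivial on all powers, hence on their
closure, and a suitable phase vector of sum zero contradicts this. Testing on sum zero lets the
lemma serve both U(d) and SU(d). -/
theorem isSidon_of_phase_mem_closure {α : Fin d → ℝ}
    (h : ∀ θ : Fin d → ℝ, ∑ j, θ j = 0 →
      phase θ ∈ closure (range fun n : ℕ => phase ((n : ℝ) • α))) :
    IsSidon fun j => (α j : ℂ) * Complex.I := by
  intro j k l m hjk hx
  have hα : α j - α k = α l - α m := by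
    have h1 : ((α j - α k : ℝ) : ℂ) * Complex.I = ((α l - α m : ℝ) : ℂ) * Complex.I := by
      push_cast
      linear_combination hx
    exact_mod_cast mul_right_cancel₀ Complex.I_ne_zero h1
  let f : Mat d → ℂ := fun M => M j j * star (M k k) * star (M l l) * M m m
  have hf : Continuous f := by
    have he : ∀ a b : Fin d, Continuous fun M : Mat d => M a b := fun a b =>
      continuous_id.matrix_elem a b
    exact (((he j j).mul (he k k).star).mul (he l l).star).mul (he m m)
  have hfp : ∀ θ : Fin d → ℝ, f (phase θ) =
      Complex.exp ((θ j - θ k - (θ l - θ m) : ℝ) * Complex.I) := by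
    intro θ
    simp only [f, phase, Matrix.diagonal_apply_eq, RCLike.star_def, ← Complex.exp_conj,
      ← Complex.exp_add]
    congr 1
    simp
    ring
  have hone : ∀ M ∈ closure (range fun n : ℕ => phase ((n : ℝ) • α)), f M = 1 := by
    have hc : IsClosed {M : Mat d | f M = 1} := isClosed_eq hf continuous_const
    refine fun M hM => closure_minimal ?_ hc hM
    rintro _ ⟨n, rfl⟩
    change f _ = 1
    rw [hfp]
    have : ((n : ℝ) • α) j - ((n : ℝ) • α) k - (((n : ℝ) • α) l - ((n : ℝ) • α) m) = 0 := by
      simp only [Pi.smul_apply, smul_eq_mul]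
      linear_combination (n : ℝ) * hα
    rw [this]
    simp
  by_contra hne
  -- A difference of two coordinates of e_j − e_k reaches its maximum 2 only at the pair (j, k), so
  -- the exponent of f is positive at v and can be rescaled to π, where f = −1.
  let v : Fin d → ℝ := Pi.single j 1 - Pi.single k 1
  have hv0 : ∑ i, v i = 0 := by simp [v, Finset.sum_sub_distrib]
  have hpos : 0 < v j - v k - (v l - v m) := by
    have hkj := hjk.symm
    simp only [v, Pi.sub_apply, Pi.single_apply]
    rw [not_and_or] at hne
    by_cases h1 : l = j <;> by_cases h2 : m = k <;> by_cases h3 : l = k <;> by_cases h4 : m = j <;>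
      simp_all <;> norm_num
  set N := v j - v k - (v l - v m)
  have h1 := hone _ (h ((Real.pi / N) • v) (by
    simp only [Pi.smul_apply, ← Finset.smul_sum, hv0, smul_zero]))
  rw [hfp] at h1
  have h2 : ((Real.pi / N) • v) j - ((Real.pi / N) • v) k -
      (((Real.pi / N) • v) l - ((Real.pi / N) • v) m) = Real.pi := by
    simp only [Pi.smul_apply, smul_eq_mul]
    have : Real.pi / N * N = Real.pi := div_mul_cancel₀ _ hpos.ne'
    linear_combination this
  rw [h2, Complex.exp_pi_mul_I] at h1
  norm_num at h1

theorem sum_ne_zero_of_phase_mem_closure (hd : 1 ≤ d) {α : Fin d → ℝ}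
    (h : ∀ θ : Fin d → ℝ, phase θ ∈ closure (range fun n : ℕ => phase ((n : ℝ) • α))) :
    ∑ j, α j ≠ 0 := by
  intro hα
  have hone : ∀ M ∈ closure (range fun n : ℕ => phase ((n : ℝ) • α)), M.det = 1 := by
    have hc : IsClosed {M : Mat d | M.det = 1} :=
      isClosed_eq (continuous_id.matrix_det) continuous_const
    refine fun M hM => closure_minimal ?_ hc hM
    rintro _ ⟨n, rfl⟩
    change Matrix.det _ = 1
    rw [det_phase]
    simp only [Pi.smul_apply, ← Finset.smul_sum, hα]
    simp
  have h1 := hone _ (h (Pi.single ⟨0, hd⟩ Real.pi))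
  rw [det_phase] at h1
  simp only [Finset.sum_pi_single', Finset.mem_univ, if_true, Complex.exp_pi_mul_I] at h1
  norm_num at h1

/-- The t with e^{it} ∈ det H form a subgroup of ℝ, closed because H is compact. It contains ∑ α_j
and 2π, whose irrational ratio makes it dense. -/
theorem exists_det_eq_of_irrational {H : Set (Mat d)} (hH : IsClosedUnitary H) {α : Fin d → ℝ}
    (hα : phase α ∈ H) (hirr : Irrational ((∑ j, α j) / (2 * Real.pi))) (φ : ℝ) :
    ∃ A ∈ H, A.det = Complex.exp (φ * Complex.I) := by
  have hcpt : IsCompact H := by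
    have : ProperSpace (Mat d) := FiniteDimensional.proper ℂ _
    refine (isCompact_closedBall (0 : Mat d) ‖(1 : Mat d)‖).of_isClosed_subset hH.isClosed
      fun A hA => ?_
    rw [mem_closedBall_zero_iff, ← mul_one A, CStarRing.norm_mem_unitary_mul _ (hH.unitary A hA)]
  have hcl : IsClosed (Matrix.det '' H) := (hcpt.image (continuous_id.matrix_det)).isClosed
  let S : AddSubgroup ℝ :=
    { carrier := {t | Complex.exp (t * Complex.I) ∈ Matrix.det '' H}
      zero_mem' := ⟨1, hH.one_mem, by simp⟩
      add_mem' := by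
        rintro s t ⟨A, hA, hA'⟩ ⟨B, hB, hB'⟩
        refine ⟨A * B, hH.mul_mem A hA B hB, ?_⟩
        rw [Matrix.det_mul, hA', hB', ← Complex.exp_add]
        push_cast
        ring_nf
      neg_mem' := by
        rintro t ⟨A, hA, hA'⟩
        refine ⟨star A, hH.star_mem A hA, ?_⟩
        rw [Matrix.star_eq_conjTranspose, Matrix.det_conjTranspose, hA', RCLike.star_def,
          ← Complex.exp_conj]
        simp }
  have hS : IsClosed (S : Set ℝ) := hcl.preimage (by fun_prop)
  have hdense := dense_addSubgroupClosure_pair_iff.2 hirr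
  have hle : AddSubgroup.closure {∑ j, α j, 2 * Real.pi} ≤ S := by
    rw [AddSubgroup.closure_le]
    rintro t (rfl | rfl)
    · exact ⟨phase α, hα, det_phase α⟩
    · refine ⟨1, hH.one_mem, ?_⟩
      simp [Complex.exp_two_pi_mul_I]
  have hφ : φ ∈ closure (S : Set ℝ) := closure_mono hle (hdense φ)
  rwa [hS.closure_eq] at hφ

end Torus

/-! ### Tori, compactness and density in U(d) and SU(d). -/

section Groups

open Filter Topology
open scoped Matrix.Norms.L2Operator

/-- The maximal torus generated by g lies in every closed subgroup containing g, so maximality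
identifies it with T. Thus maximality of the diagonal torus need not be proved separately. -/
theorem IsGeneral.closure_powers_eq {G : Type*} [Group G] [TopologicalSpace G] {g : G}
    (hg : IsGeneral g) {T : Subgroup G} (hT : IsTorus T) (hgT : g ∈ T) :
    closure (Submonoid.powers g : Set G) = T := by
  obtain ⟨K, hK, hgK⟩ := hg
  have hKT : K ≤ T := by
    intro x hx
    have hx' : x ∈ closure (Submonoid.powers g : Set G) := by rw [hgK]; exact hx
    refine closure_minimal ?_ hT.1 hx'
    rintro _ ⟨n, rfl⟩
    exact T.pow_mem hgT n
  rw [hgK, le_antisymm hKT (hK.2 hT hKT)]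

variable {d : ℕ}

theorem isCompact_unitaryGroup : IsCompact (Matrix.unitaryGroup (Fin d) ℂ : Set (Mat d)) := by
  have : ProperSpace (Mat d) := FiniteDimensional.proper ℂ _
  refine (isCompact_closedBall (0 : Mat d) ‖(1 : Mat d)‖).of_isClosed_subset isClosed_unitary
    fun A hA => ?_
  rw [mem_closedBall_zero_iff, ← mul_one A, CStarRing.norm_mem_unitary_mul _ hA]

theorem isCompact_specialUnitaryGroup :
    IsCompact (Matrix.specialUnitaryGroup (Fin d) ℂ : Set (Mat d)) := by
  have h : (Matrix.specialUnitaryGroup (Fin d) ℂ : Set (Mat d)) =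
      (Matrix.unitaryGroup (Fin d) ℂ : Set (Mat d)) ∩ {A | A.det = 1} := by
    ext A
    exact Matrix.mem_specialUnitaryGroup_iff
  rw [h]
  exact isCompact_unitaryGroup.inter_right (isClosed_eq (continuous_id.matrix_det) continuous_const)

instance : CompactSpace (UGroup d) := isCompact_iff_compactSpace.1 isCompact_unitaryGroup

instance : CompactSpace (SUGroup d) := isCompact_iff_compactSpace.1 isCompact_specialUnitaryGroup

instance : IsTopologicalGroup (SUGroup d) where
  continuous_inv := (continuous_subtype_val.star).subtype_mk _

theorem isClosedUnitary_image_U {K : Subgroup (UGroup d)} (hK : IsClosed (K : Set (UGroup d))) :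
    IsClosedUnitary ((Subtype.val : UGroup d → Mat d) '' K) where
  isClosed := (hK.isCompact.image continuous_subtype_val).isClosed
  unitary := by rintro _ ⟨u, _, rfl⟩; exact u.2
  one_mem := ⟨1, K.one_mem, rfl⟩
  mul_mem := by
    rintro _ ⟨u, hu, rfl⟩ _ ⟨v, hv, rfl⟩
    exact ⟨u * v, K.mul_mem hu hv, rfl⟩
  star_mem := by
    rintro _ ⟨u, hu, rfl⟩
    exact ⟨u⁻¹, K.inv_mem hu, rfl⟩

theorem isClosedUnitary_image_SU {K : Subgroup (SUGroup d)} (hK : IsClosed (K : Set (SUGroup d))) :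
    IsClosedUnitary ((Subtype.val : SUGroup d → Mat d) '' K) where
  isClosed := (hK.isCompact.image continuous_subtype_val).isClosed
  unitary := by
    rintro _ ⟨u, _, rfl⟩
    exact Matrix.specialUnitaryGroup_le_unitaryGroup u.2
  one_mem := ⟨1, K.one_mem, rfl⟩
  mul_mem := by
    rintro _ ⟨u, hu, rfl⟩ _ ⟨v, hv, rfl⟩
    exact ⟨u * v, K.mul_mem hu hv, rfl⟩
  star_mem := by
    rintro _ ⟨u, hu, rfl⟩
    exact ⟨u⁻¹, K.inv_mem hu, rfl⟩

/-- In a compact group inverses are limits of positive powers, so products of gates and the subgroup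
they generate have the same closure. -/
theorem isUniversal_iff {G : Type*} [Group G] [TopologicalSpace G] [CompactSpace G]
    [IsTopologicalGroup G] {S : Set G} :
    IsUniversal S ↔ ∀ u, u ∈ (Subgroup.closure S).topologicalClosure := by
  rw [IsUniversal, closure_submonoidClosure_eq_closure_subgroupClosure, eq_univ_iff_forall]
  rfl

/-- The diagonal matrices in `U(d)`. -/
def diagU (d : ℕ) : Subgroup (UGroup d) where
  carrier := {u | (u : Mat d).IsDiag}
  one_mem' := Matrix.isDiag_one
  mul_mem' {u v} hu hv := by
    change ((u : Mat d) * (v : Mat d)).IsDiag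
    have hu' : (u : Mat d).IsDiag := hu
    have hv' : (v : Mat d).IsDiag := hv
    rw [← hu'.diagonal_diag, ← hv'.diagonal_diag, Matrix.diagonal_mul_diagonal]
    exact Matrix.isDiag_diagonal _
  inv_mem' {u} hu := Matrix.IsDiag.conjTranspose (A := (u : Mat d)) hu

/-- The diagonal matrices in `SU(d)`. -/
def diagSU (d : ℕ) : Subgroup (SUGroup d) where
  carrier := {u | (u : Mat d).IsDiag}
  one_mem' := Matrix.isDiag_one
  mul_mem' {u v} hu hv := by
    change ((u : Mat d) * (v : Mat d)).IsDiag
    have hu' : (u : Mat d).IsDiag := hu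
    have hv' : (v : Mat d).IsDiag := hv
    rw [← hu'.diagonal_diag, ← hv'.diagonal_diag, Matrix.diagonal_mul_diagonal]
    exact Matrix.isDiag_diagonal _
  inv_mem' {u} hu := Matrix.IsDiag.conjTranspose (A := (u : Mat d)) hu

theorem isClosed_isDiag : IsClosed {A : Mat d | A.IsDiag} := by
  have : {A : Mat d | A.IsDiag} = ⋂ (i) (j) (_ : i ≠ j), {A | A i j = 0} := by
    ext A
    simp [Matrix.IsDiag, Pairwise]
  rw [this]
  exact isClosed_iInter fun i => isClosed_iInter fun j => isClosed_iInter fun _ =>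
    isClosed_eq (continuous_id.matrix_elem i j) continuous_const

theorem isTorus_diagU : IsTorus (diagU d) := by
  refine ⟨isClosed_isDiag.preimage continuous_subtype_val, ?_,
    fun x hx y hy => Subtype.ext (mul_comm_of_isDiag hx hy)⟩
  have h : (diagU d : Set (UGroup d)) =
      range fun θ : Fin d → ℝ => (⟨phase θ, phase_mem_unitaryGroup θ⟩ : UGroup d) := by
    ext u
    constructor
    · intro hu
      obtain ⟨θ, hθ⟩ := exists_phase_eq_of_isDiag u.2 hu
      exact ⟨θ, Subtype.ext hθ.symm⟩
    · rintro ⟨θ, rfl⟩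
      exact Matrix.isDiag_diagonal _
  rw [h]
  exact isConnected_range (continuous_phase.subtype_mk _)

theorem phase_mem_specialUnitaryGroup {θ : Fin d → ℝ} (hθ : ∑ j, θ j = 0) :
    phase θ ∈ Matrix.specialUnitaryGroup (Fin d) ℂ :=
  Matrix.mem_specialUnitaryGroup_iff.2 ⟨phase_mem_unitaryGroup θ, by rw [det_phase, hθ]; simp⟩

theorem isTorus_diagSU : IsTorus (diagSU d) := by
  refine ⟨isClosed_isDiag.preimage continuous_subtype_val, ?_,
    fun x hx y hy => Subtype.ext (mul_comm_of_isDiag hx hy)⟩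
  have h : (diagSU d : Set (SUGroup d)) = range fun θ : {θ : Fin d → ℝ | ∑ j, θ j = 0} =>
      (⟨phase θ.1, phase_mem_specialUnitaryGroup θ.2⟩ : SUGroup d) := by
    ext u
    constructor
    · intro hu
      obtain ⟨hu1, hu2⟩ := Matrix.mem_specialUnitaryGroup_iff.1 u.2
      obtain ⟨θ, hθ⟩ := exists_phase_eq_of_isDiag hu1 hu
      rw [hθ] at hu2
      obtain ⟨η, hη, hηθ⟩ := exists_sum_eq_zero_of_det_phase hu2
      exact ⟨⟨η, hη⟩, Subtype.ext (hηθ.trans hθ.symm)⟩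
    · rintro ⟨θ, rfl⟩
      exact Matrix.isDiag_diagonal _
  rw [h]
  have hconv : Convex ℝ {θ : Fin d → ℝ | ∑ j, θ j = 0} := by
    intro x hx y hy a b _ _ _
    have hx' : ∑ j, x j = 0 := hx
    have hy' : ∑ j, y j = 0 := hy
    change ∑ j, (a • x + b • y) j = 0
    simp [Finset.sum_add_distrib, ← Finset.mul_sum, hx', hy']
  have : ConnectedSpace {θ : Fin d → ℝ | ∑ j, θ j = 0} :=
    isConnected_iff_connectedSpace.1 (hconv.isConnected ⟨0, by simp⟩)
  exact isConnected_range ((continuous_phase.comp continuous_subtype_val).subtype_mk _)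

end Groups

/-! ### Universality of the two gates. -/

section Generators

open Filter Topology
open scoped Matrix.Norms.L2Operator

variable {d : ℕ}

theorem coe_expU_eq_phase {X : uLie d} {α : Fin d → ℝ}
    (hX : (X : Mat d) = Matrix.diagonal fun j => (α j : ℂ) * Complex.I) :
    ((expU X : UGroup d) : Mat d) = phase α := by
  rw [← exp_diagonal_mul_I, ← hX]
  rfl

theorem coe_expSU_eq_phase {X : suLie d} {α : Fin d → ℝ}
    (hX : (X : Mat d) = Matrix.diagonal fun j => (α j : ℂ) * Complex.I) :
    ((expSU X : SUGroup d) : Mat d) = phase α := by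
  rw [← exp_diagonal_mul_I, ← hX]
  rfl

theorem phase_mem_closure_powers_expU {X : uLie d} {α : Fin d → ℝ}
    (hX : (X : Mat d) = Matrix.diagonal fun j => (α j : ℂ) * Complex.I)
    (hg : IsGeneral (expU X)) (θ : Fin d → ℝ) :
    (⟨phase θ, phase_mem_unitaryGroup θ⟩ : UGroup d) ∈
      closure (Submonoid.powers (expU X) : Set (UGroup d)) := by
  rw [hg.closure_powers_eq isTorus_diagU (by
    change ((expU X : UGroup d) : Mat d).IsDiag
    rw [coe_expU_eq_phase hX]
    exact Matrix.isDiag_diagonal _)]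
  exact Matrix.isDiag_diagonal _

theorem phase_mem_closure_powers_expSU {X : suLie d} {α : Fin d → ℝ}
    (hX : (X : Mat d) = Matrix.diagonal fun j => (α j : ℂ) * Complex.I)
    (hg : IsGeneral (expSU X)) {θ : Fin d → ℝ} (hθ : ∑ j, θ j = 0) :
    (⟨phase θ, phase_mem_specialUnitaryGroup hθ⟩ : SUGroup d) ∈
      closure (Submonoid.powers (expSU X) : Set (SUGroup d)) := by
  rw [hg.closure_powers_eq isTorus_diagSU (by
    change ((expSU X : SUGroup d) : Mat d).IsDiag
    rw [coe_expSU_eq_phase hX]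
    exact Matrix.isDiag_diagonal _)]
  exact Matrix.isDiag_diagonal _

theorem phase_mem_closure_range_of_isGeneral_expU {X : uLie d} {α : Fin d → ℝ}
    (hX : (X : Mat d) = Matrix.diagonal fun j => (α j : ℂ) * Complex.I)
    (hg : IsGeneral (expU X)) (θ : Fin d → ℝ) :
    phase θ ∈ closure (range fun n : ℕ => phase ((n : ℝ) • α)) := by
  have h := image_closure_subset_closure_image (continuous_subtype_val (p := (· ∈ _)))
    (mem_image_of_mem _ (phase_mem_closure_powers_expU hX hg θ))
  refine closure_mono ?_ h
  rintro _ ⟨_, ⟨n, rfl⟩, rfl⟩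
  exact ⟨n, by simp only [← phase_pow, ← coe_expU_eq_phase hX]; rfl⟩

theorem phase_mem_closure_range_of_isGeneral_expSU {X : suLie d} {α : Fin d → ℝ}
    (hX : (X : Mat d) = Matrix.diagonal fun j => (α j : ℂ) * Complex.I)
    (hg : IsGeneral (expSU X)) (θ : Fin d → ℝ) (hθ : ∑ j, θ j = 0) :
    phase θ ∈ closure (range fun n : ℕ => phase ((n : ℝ) • α)) := by
  have h := image_closure_subset_closure_image (continuous_subtype_val (p := (· ∈ _)))
    (mem_image_of_mem _ (phase_mem_closure_powers_expSU hX hg hθ))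
  refine closure_mono ?_ h
  rintro _ ⟨_, ⟨n, rfl⟩, rfl⟩
  exact ⟨n, by simp only [← phase_pow, ← coe_expSU_eq_phase hX]; rfl⟩

theorem coe_smul_eq_diagonal {X : Mat d} {α : Fin d → ℝ}
    (hX : X = Matrix.diagonal fun j => (α j : ℂ) * Complex.I) (s : ℝ) :
    s • X = Matrix.diagonal fun j => ((s • α) j : ℂ) * Complex.I := by
  rw [hX, smul_diagonal_mul_I]

theorem closure_powers_subset {G : Type*} [Group G] [TopologicalSpace G] [IsTopologicalGroup G]
    {g : G} {S : Set G} (hg : g ∈ S) :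
    closure (Submonoid.powers g : Set G) ⊆ (Subgroup.closure S).topologicalClosure := by
  refine closure_mono ?_
  rintro _ ⟨n, rfl⟩
  exact Subgroup.pow_mem _ (Subgroup.subset_closure hg) n

/-- A pair is universal if every closed group of matrices containing it is the whole of `U(d)`;
such a group also contains the closure of the powers of the first element. -/
theorem isUniversal_pair_U {a b : UGroup d}
    (h : ∀ H : Set (Mat d), IsClosedUnitary H → (a : Mat d) ∈ H → (b : Mat d) ∈ H →
      ((Subtype.val : UGroup d → Mat d) '' closure (Submonoid.powers a : Set (UGroup d)) ⊆ H) →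
      ∀ u ∈ Matrix.unitaryGroup (Fin d) ℂ, u ∈ H) :
    IsUniversal ({a, b} : Set (UGroup d)) := by
  rw [isUniversal_iff]
  intro u
  set K := (Subgroup.closure ({a, b} : Set (UGroup d))).topologicalClosure
  have hK : IsClosed (K : Set (UGroup d)) := Subgroup.isClosed_topologicalClosure _
  have hmem : ∀ x ∈ ({a, b} : Set (UGroup d)), x ∈ K := fun x hx =>
    Subgroup.le_topologicalClosure _ (Subgroup.subset_closure hx)
  obtain ⟨v, hv, hvu⟩ := h _ (isClosedUnitary_image_U hK) ⟨a, hmem a (by simp), rfl⟩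
    ⟨b, hmem b (by simp), rfl⟩ (image_mono (closure_powers_subset (by simp))) u u.2
  rwa [Subtype.ext hvu] at hv

theorem isUniversal_pair_SU {a b : SUGroup d}
    (h : ∀ H : Set (Mat d), IsClosedUnitary H → (a : Mat d) ∈ H → (b : Mat d) ∈ H →
      ((Subtype.val : SUGroup d → Mat d) '' closure (Submonoid.powers a : Set (SUGroup d)) ⊆ H) →
      ∀ u ∈ Matrix.specialUnitaryGroup (Fin d) ℂ, u ∈ H) :
    IsUniversal ({a, b} : Set (SUGroup d)) := by
  rw [isUniversal_iff]
  intro u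
  set K := (Subgroup.closure ({a, b} : Set (SUGroup d))).topologicalClosure
  have hK : IsClosed (K : Set (SUGroup d)) := Subgroup.isClosed_topologicalClosure _
  have hmem : ∀ x ∈ ({a, b} : Set (SUGroup d)), x ∈ K := fun x hx =>
    Subgroup.le_topologicalClosure _ (Subgroup.subset_closure hx)
  obtain ⟨v, hv, hvu⟩ := h _ (isClosedUnitary_image_SU hK) ⟨a, hmem a (by simp), rfl⟩
    ⟨b, hmem b (by simp), rfl⟩ (image_mono (closure_powers_subset (by simp))) u u.2
  rwa [Subtype.ext hvu] at hv

theorem isUniversal_of_isGeneral_U (hd : 1 ≤ d) {c : Fin (d - 1) → ℝ} (hc : ∀ j, c j ≠ 0)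
    {X : uLie d} {α : Fin d → ℝ}
    (hX : (X : Mat d) = Matrix.diagonal fun j => (α j : ℂ) * Complex.I)
    (hS : IsSidon fun j => (α j : ℂ) * Complex.I) {ε : ℝ} (hε : 0 < ε)
    (hs : IsSmallStep (chain d c) ε) (hg : IsGeneral (expU (ε • X))) :
    IsUniversal ({expU (ε • X), expU (ε • chainU d c)} : Set (UGroup d)) := by
  refine isUniversal_pair_U fun H hH _ h2 hcl u hu => ?_
  have hphase : ∀ θ, phase θ ∈ H := fun θ => hcl ⟨_, phase_mem_closure_powers_expU
    (X := ε • X) (coe_smul_eq_diagonal hX ε) hg θ, rfl⟩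
  refine unitary_mem_of_suLie_le_tangent hH (fun Z hZ => ?_) (fun φ => ?_) hu
  · refine suLie_le_tangent_of_exp_smul_mem hH hS (diagonal_mul_I_mem_uLie α) hc hε
      (fun s => ?_) h2 hs hZ
    rw [smul_diagonal_mul_I, exp_diagonal_mul_I]
    exact hphase _
  -- A single phase on the torus already realizes any determinant on the unit circle.
  · refine ⟨_, hphase (Pi.single ⟨0, hd⟩ φ), ?_⟩
    rw [det_phase]
    simp

theorem isUniversal_of_isGeneral_SU {c : Fin (d - 1) → ℝ} (hc : ∀ j, c j ≠ 0)
    {X : suLie d} {α : Fin d → ℝ}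
    (hX : (X : Mat d) = Matrix.diagonal fun j => (α j : ℂ) * Complex.I) (hα : ∑ j, α j = 0)
    (hS : IsSidon fun j => (α j : ℂ) * Complex.I) {ε : ℝ} (hε : 0 < ε)
    (hs : IsSmallStep (chain d c) ε) (hg : IsGeneral (expSU (ε • X))) :
    IsUniversal ({expSU (ε • X), expSU (ε • chainSU d c)} : Set (SUGroup d)) := by
  refine isUniversal_pair_SU fun H hH _ h2 hcl u hu => ?_
  refine specialUnitary_mem_of_suLie_le_tangent hH (fun Z hZ => ?_) hu
  refine suLie_le_tangent_of_exp_smul_mem hH hS (diagonal_mul_I_mem_uLie α) hc hε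
    (fun s => ?_) h2 hs hZ
  rw [smul_diagonal_mul_I, exp_diagonal_mul_I]
  exact hcl ⟨_, phase_mem_closure_powers_expSU (X := ε • X) (coe_smul_eq_diagonal hX ε) hg
    (by simp [← Finset.mul_sum, hα]), rfl⟩

theorem countable_not_irrational_mul {r : ℝ} (hr : r ≠ 0) :
    {ε : ℝ | ¬ Irrational (ε * r)}.Countable := by
  have h : {ε : ℝ | ¬ Irrational (ε * r)} = (fun ε => ε * r) ⁻¹' range ((↑) : ℚ → ℝ) := by
    ext ε
    simp [Irrational]
  rw [h]
  exact (countable_range _).preimage_of_injOn (mul_left_injective₀ hr).injOn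

theorem exists_isUniversal_U {c : Fin (d - 1) → ℝ} (hc : ∀ j, c j ≠ 0)
    {X : uLie d} {α : Fin d → ℝ}
    (hX : (X : Mat d) = Matrix.diagonal fun j => (α j : ℂ) * Complex.I)
    (hS : IsSidon fun j => (α j : ℂ) * Complex.I) (hα : ∑ j, α j ≠ 0) :
    ∃ ε₀ : ℝ, 0 < ε₀ ∧ ∃ N : Set ℝ, N.Countable ∧ ∀ ε ∈ Ioo 0 ε₀, ε ∉ N →
      IsUniversal ({expU (ε • X), expU (ε • chainU d c)} : Set (UGroup d)) := by
  obtain ⟨ε₀, hε₀, h⟩ := exists_step_bound (X : Mat d) (chain d c)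
  have hr : (∑ j, α j) / (2 * Real.pi) ≠ 0 := div_ne_zero hα (by positivity)
  refine ⟨ε₀, hε₀, _, countable_not_irrational_mul hr, fun ε hε hN => ?_⟩
  obtain ⟨b1, b2, b3, b4⟩ := h ε hε
  rw [hX] at b1 b3
  rw [mem_ofPred_eq, not_not] at hN
  refine isUniversal_pair_U fun H hH h1 h2 _ u hu => ?_
  have h1' : phase (ε • α) ∈ H := by
    rw [← coe_expU_eq_phase (X := ε • X) (coe_smul_eq_diagonal hX ε)]
    exact h1
  refine unitary_mem_of_suLie_le_tangent hH (fun Z hZ => ?_)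
    (exists_det_eq_of_irrational hH h1' ?_) hu
  · refine suLie_le_tangent_of_small hH hS (diagonal_mul_I_mem_uLie α) hc hε.1 ?_ h2 b1 b2 b3 b4 hZ
    rwa [smul_diagonal_mul_I, exp_diagonal_mul_I]
  · simpa only [Pi.smul_apply, smul_eq_mul, ← Finset.mul_sum, mul_div_assoc] using hN

theorem exists_isUniversal_SU {c : Fin (d - 1) → ℝ} (hc : ∀ j, c j ≠ 0)
    {X : suLie d} {α : Fin d → ℝ}
    (hX : (X : Mat d) = Matrix.diagonal fun j => (α j : ℂ) * Complex.I)
    (hS : IsSidon fun j => (α j : ℂ) * Complex.I) :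
    ∃ ε₀ : ℝ, 0 < ε₀ ∧ ∀ ε ∈ Ioo 0 ε₀,
      IsUniversal ({expSU (ε • X), expSU (ε • chainSU d c)} : Set (SUGroup d)) := by
  obtain ⟨ε₀, hε₀, h⟩ := exists_step_bound (X : Mat d) (chain d c)
  refine ⟨ε₀, hε₀, fun ε hε => ?_⟩
  obtain ⟨b1, b2, b3, b4⟩ := h ε hε
  rw [hX] at b1 b3
  refine isUniversal_pair_SU fun H hH h1 h2 _ u hu => ?_
  refine specialUnitary_mem_of_suLie_le_tangent hH (fun Z hZ => ?_) hu
  refine suLie_le_tangent_of_small hH hS (diagonal_mul_I_mem_uLie α) hc hε.1 ?_ h2 b1 b2 b3 b4 hZ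
  rw [← hX]
  exact h1

end Generators

end TwoGen

/-! ### The theorem for U(d) and SU(d). -/

theorem mainTheorem3 (d : ℕ) (hd : 1 ≤ d) (c : Fin (d - 1) → ℝ) (hc : ∀ j, c j ≠ 0) :
    (∀ X₁ : TwoGen.uLie d, TwoGen.IsDiagGeneralDirectionU X₁ →
      LieSubalgebra.lieSpan ℝ (TwoGen.Mat d) {(X₁ : TwoGen.Mat d), TwoGen.chain d c}
          = TwoGen.uLie d ∧
      (∀ ε : ℝ, 0 < ε →
        TwoGen.opNorm (NormedSpace.exp (ε • (X₁ : TwoGen.Mat d)) - 1) < √2 →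
        TwoGen.IsSmallStep (TwoGen.chain d c) ε →
        TwoGen.IsGeneral (TwoGen.expU (ε • X₁)) →
        TwoGen.IsUniversal
          ({TwoGen.expU (ε • X₁), TwoGen.expU (ε • TwoGen.chainU d c)} :
            Set (TwoGen.UGroup d))) ∧
      (∃ ε₀ : ℝ, 0 < ε₀ ∧ ∃ N : Set ℝ, N.Countable ∧ ∀ ε ∈ Set.Ioo 0 ε₀, ε ∉ N →
        TwoGen.IsUniversal
          ({TwoGen.expU (ε • X₁), TwoGen.expU (ε • TwoGen.chainU d c)} :
            Set (TwoGen.UGroup d)))) ∧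
    (∀ X₁ : TwoGen.suLie d, TwoGen.IsDiagGeneralDirectionSU X₁ →
      LieSubalgebra.lieSpan ℝ (TwoGen.Mat d) {(X₁ : TwoGen.Mat d), TwoGen.chain d c}
          = TwoGen.suLie d ∧
      (∀ ε : ℝ, 0 < ε →
        TwoGen.opNorm (NormedSpace.exp (ε • (X₁ : TwoGen.Mat d)) - 1) < √2 →
        TwoGen.IsSmallStep (TwoGen.chain d c) ε →
        TwoGen.IsGeneral (TwoGen.expSU (ε • X₁)) →
        TwoGen.IsUniversal
          ({TwoGen.expSU (ε • X₁), TwoGen.expSU (ε • TwoGen.chainSU d c)} :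
            Set (TwoGen.SUGroup d))) ∧
      (∃ ε₀ : ℝ, 0 < ε₀ ∧ ∀ ε ∈ Set.Ioo 0 ε₀,
        TwoGen.IsUniversal
          ({TwoGen.expSU (ε • X₁), TwoGen.expSU (ε • TwoGen.chainSU d c)} :
            Set (TwoGen.SUGroup d)))) := by
  refine ⟨fun X hX => ?_, fun X hX => ?_⟩
  · obtain ⟨hdiag, hgen⟩ := hX
    obtain ⟨α, hα⟩ := TwoGen.exists_eq_diagonal_mul_I X.2 hdiag
    have hcl := TwoGen.phase_mem_closure_range_of_isGeneral_expU hα hgen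
    -- Generality of exp X₁ enters only through the Sidon property and the nonvanishing trace; claim
    -- 3 never needs exp(εX₁) to be general.
    have hS := TwoGen.isSidon_of_phase_mem_closure fun θ _ => hcl θ
    have hsum := TwoGen.sum_ne_zero_of_phase_mem_closure hd hcl
    refine ⟨?_, fun ε hε _ hs hg => TwoGen.isUniversal_of_isGeneral_U hd hc hα hS hε hs hg,
      TwoGen.exists_isUniversal_U hc hα hS hsum⟩
    rw [hα]
    refine TwoGen.lieSpan_eq_uLie hS (TwoGen.diagonal_mul_I_mem_uLie α) ?_ hc
    rw [TwoGen.trace_diagonal_mul_I]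
    exact mul_ne_zero (Complex.ofReal_ne_zero.2 hsum) Complex.I_ne_zero
  · obtain ⟨hdiag, hgen⟩ := hX
    obtain ⟨α, hα⟩ := TwoGen.exists_eq_diagonal_mul_I X.2.1 hdiag
    have hS := TwoGen.isSidon_of_phase_mem_closure
      (TwoGen.phase_mem_closure_range_of_isGeneral_expSU hα hgen)
    have htr : (X : TwoGen.Mat d).trace = 0 := X.2.2
    have hsum : ∑ j, α j = 0 := by
      rw [hα, TwoGen.trace_diagonal_mul_I] at htr
      exact_mod_cast (mul_eq_zero.1 htr).resolve_right Complex.I_ne_zero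
    refine ⟨?_, fun ε hε _ hs hg => TwoGen.isUniversal_of_isGeneral_SU hc hα hsum hS hε hs hg,
      TwoGen.exists_isUniversal_SU hc hα hS⟩
    have hX := X.2
    rw [hα] at hX ⊢
    exact TwoGen.lieSpan_eq_suLie hS hX hc
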